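/- For every $n$ let $d=d(n)$ and $p=p(n)$ be positive integers with $d<n^{1/2}$ for all sufficiently large $n$, put $N=N(n)=\binom{n}{d}$, and suppose $N/p\to\gamma\in(0,\infty)$ as $n\to\infty$. Let $x(n)$ be a real random variable and $C=C(n)\ge 2$ a real number such that $x(n)\overset{d}{=}-x(n)$, $\mathbb{E}[x(n)^2]=1$, $\mathbb{E}[x(n)^{2k}]\le (Ck)^k$ for all $k\in\mathbb{N}$, and $$\lim_{n\to\infty}\frac{\log C(n)}{\log\big(n^{1/2}/d(n)\big)}=0 .$$ Let $Z_0=(x_{i_1}x_{i_2}\cdots x_{i_d})_{1\le i_1<\cdots<i_d\le n}\in\mathbb{R}^{N}$, where $x_1,\dots,x_n$ are i.i.d. copies of $x(n)$, and let $Z=Z(n)\in\mathbb{R}^{N\times p}$ be random matrices, all defined on one probability space (with arbitrary joint distribution over different $n$), such that for each $n$ the $p$ columns of $Z(n)$ are i.i.d. with the law of $Z_0$. Let $S=\frac1p ZZ^T$ with eigenvalues $\lambda_1(S),\dots,\lambda_N(S)$, counted with multiplicity, and let $F_S(x)=\frac1N\#\{j:\lambda_j(S)\le x\}$ be its empirical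 spectral distribution. Then, almost surely, $F_{S(n)}$ converges weakly as $n\to\infty$ (that is, $F_{S(n)}(x)\to F_\gamma(x)$ at every continuity point $x$ of $F_\gamma$) to the Marchenko–Pastur law $$F_\gamma(x)=\Big(1-\frac1\gamma\Big)\chi_{x\ge 0,\ \gamma>1}+\int_{-\infty}^x p_\gamma(y)\,dy,$$ where $$p_\gamma(y)=\frac{\sqrt{\big((1+\sqrt\gamma)^2-y\big)\big(y-(1-\sqrt\gamma)^2\big)}}{2\pi\gamma y}$$ for $y\in[(1-\sqrt\gamma)^2,(1+\sqrt\gamma)^2]$ and $p_\gamma(y)=0$ otherwise. -/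

import Mathlib

open MeasureTheory ProbabilityTheory Filter Topology

noncomputable section

namespace RandomTensor

/-- The strictly increasing tuples `i₁ < ⋯ < i_d` of indices in `{1, …, n}`, encoded as the
`d`-element subsets of `Fin n`. There are `n.choose d` of them. -/
abbrev TensorIndex (n d : ℕ) : Type := {s : Finset (Fin n) // s.card = d}

/-- The vector `(x_{i₁} ⋯ x_{i_d})_{i₁ < ⋯ < i_d}` built from `x = (x₁, …, x_n)`. -/
def tensorVector (n d : ℕ) (x : Fin n → ℝ) : TensorIndex n d → ℝ :=
  fun s => ∏ i ∈ s.1, x i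

/-- The law of the random vector `(x_{i₁} ⋯ x_{i_d})_{i₁ < ⋯ < i_d}` when `x₁, …, x_n` are
i.i.d. with law `μ`. -/
def tensorLaw (n d : ℕ) (μ : Measure ℝ) : Measure (TensorIndex n d → ℝ) :=
  (Measure.pi fun _ : Fin n => μ).map (tensorVector n d)

/-- The sample covariance matrix `p⁻¹ Z Zᵀ` of a matrix `Z` with `p` columns. -/
def sampleCov {ι : Type*} {p : ℕ} (Z : Matrix ι (Fin p) ℝ) : Matrix ι ι ℝ :=
  (1 / (p : ℝ)) • (Z * Z.transpose)

theorem sampleCov_isHermitian {ι : Type*} {p : ℕ} (Z : Matrix ι (Fin p) ℝ) :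
    (sampleCov Z).IsHermitian := by
  ext i j
  simp [sampleCov, Matrix.mul_apply, mul_comm]

/-- The empirical spectral distribution function of a real symmetric matrix `A`: the proportion
of eigenvalues of `A`, counted with multiplicity, that are at most `x`. -/
def esd {ι : Type*} [Fintype ι] [DecidableEq ι] {A : Matrix ι ι ℝ} (hA : A.IsHermitian)
    (x : ℝ) : ℝ :=
  (1 / (Fintype.card ι : ℝ)) * ∑ j : ι, (Set.Ici (hA.eigenvalues j)).indicator 1 x

/-- The density of the absolutely continuous part of the Marchenko–Pastur law. -/
def mpDensity (γ y : ℝ) : ℝ :=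
  (Set.Icc ((1 - √γ) ^ 2) ((1 + √γ) ^ 2)).indicator
    (fun y => √(((1 + √γ) ^ 2 - y) * (y - (1 - √γ) ^ 2)) / (2 * Real.pi * γ * y)) y

/-- The distribution function of the Marchenko–Pastur law with parameter `γ`. -/
def mpCDF (γ x : ℝ) : ℝ :=
  (if 0 ≤ x ∧ 1 < γ then 1 - 1 / γ else 0) + ∫ y in Set.Iic x, mpDensity γ y

/-- Weak convergence of distribution functions: convergence at every continuity point of the
limit. -/
def WeaklyConverges (F : ℕ → ℝ → ℝ) (G : ℝ → ℝ) : Prop :=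
  ∀ x : ℝ, ContinuousAt G x → Tendsto (fun n => F n x) atTop (𝓝 (G x))

end RandomTensor

end

/-! For `t > 0` put `R = (S + t)⁻¹` and `m = N⁻¹ tr R`, the Stieltjes transform of the spectral
distribution at `-t`. Sherman–Morrison, applied to each column, gives the exact identity `N - t tr R
= ∑ⱼ (1 - 1 / (1 + qⱼ))` (`card_sub_trace_eq`), where `qⱼ = p⁻¹ zⱼᵀ R⁽ʲ⁾ zⱼ` and the resolvent
`R⁽ʲ⁾` omits column `j`, hence is independent of `zⱼ`.

The probabilistic core is that `zᵀ A z` is close to `tr A` for a random tensor `z` and a fixed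
matrix `A` with bounded rows (`IsEntryLaw.quadForm_variance_le`): the variance is at most `4 N² K²
(exp (2 M d² / n) - 1)`, where `M` bounds the fourth moment. Mixed moments of four entries vanish
unless every index occurs an even number of times, and two random `d`-subsets rarely meet when `d² ≪
n`. With `M = 4 C²` the rate tends to zero, because the condition on `log C` makes `C d / √n` tend
to zero. So `qⱼ` is close to `p⁻¹ tr R⁽ʲ⁾`, which a rank-one bound compares with `(N / p) m`.

Replacing one column moves `m` by at most `1 / (t N)`, so the bounded differences inequality gives
tails exponentially small in `N ≥ n`. By Borel–Cantelli `m` is almost surely asymptotic to its mean,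
and the mean satisfies `g (1 - t m) ≈ 1 - 1 / (1 + g m)` with `g = N / p` (`abs_selfConsistent_le`).
In the limit this is a quadratic with a single positive root (`tendsto_of_selfConsistent`), and an
explicit integration shows that the root is the Stieltjes transform of the Marchenko–Pastur law
(`mpMeasure_selfConsistent`).

Finally, convergence of the transforms for a countable dense set of `t` holds off one null set, and
it forces weak convergence: after compactifying `[0, ∞]`, constants and the kernels `1 / (x + t)`
span a dense space of continuous functions (`tendsto_cdf_of_stieltjes`). -/

noncomputable section

namespace RandomTensor

set_option linter.unusedSectionVars false

/-! ### Rank-one perturbation of inverses of positive definite matrices. -/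

section LinearAlgebra

open Matrix

variable {ι : Type*} [Fintype ι] [DecidableEq ι]

/-- The matrix `B` is symmetric and bounded below by `t > 0`. -/
structure BoundedBelow (t : ℝ) (B : Matrix ι ι ℝ) : Prop where
  pos : 0 < t
  symm : Bᵀ = B
  le : ∀ u : ι → ℝ, t * (u ⬝ᵥ u) ≤ u ⬝ᵥ (B *ᵥ u)

namespace BoundedBelow

variable {t : ℝ} {B : Matrix ι ι ℝ}

theorem dotProduct_self_nonneg' (u : ι → ℝ) : 0 ≤ u ⬝ᵥ u :=
  Finset.sum_nonneg fun i _ => mul_self_nonneg (u i)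

theorem isUnit_det (h : BoundedBelow t B) : IsUnit B.det := by
  rw [isUnit_iff_ne_zero]
  intro h0
  obtain ⟨v, hv, hBv⟩ := Matrix.exists_mulVec_eq_zero_iff.2 h0
  have h1 := h.le v
  rw [hBv, dotProduct_zero] at h1
  have h2 : v ⬝ᵥ v = 0 := by
    nlinarith [h.pos, dotProduct_self_nonneg' v]
  exact hv (dotProduct_self_eq_zero.1 h2)

theorem mulVec_inv_mulVec (h : BoundedBelow t B) (v : ι → ℝ) : B *ᵥ (B⁻¹ *ᵥ v) = v := by
  rw [mulVec_mulVec, mul_nonsing_inv _ h.isUnit_det, one_mulVec]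

theorem inv_mulVec_mulVec (h : BoundedBelow t B) (v : ι → ℝ) : B⁻¹ *ᵥ (B *ᵥ v) = v := by
  rw [mulVec_mulVec, nonsing_inv_mul _ h.isUnit_det, one_mulVec]

theorem inv_transpose (h : BoundedBelow t B) : (B⁻¹)ᵀ = B⁻¹ := by
  rw [transpose_nonsing_inv, h.symm]

/-- `|B⁻¹ v|² ≤ t⁻¹ vᵀ B⁻¹ v`. -/
theorem normSq_inv_mulVec_le (h : BoundedBelow t B) (v : ι → ℝ) :
    t * ((B⁻¹ *ᵥ v) ⬝ᵥ (B⁻¹ *ᵥ v)) ≤ v ⬝ᵥ (B⁻¹ *ᵥ v) := by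
  have := h.le (B⁻¹ *ᵥ v)
  rwa [h.mulVec_inv_mulVec, dotProduct_comm (B⁻¹ *ᵥ v) v] at this

theorem quadForm_inv_nonneg (h : BoundedBelow t B) (v : ι → ℝ) : 0 ≤ v ⬝ᵥ (B⁻¹ *ᵥ v) :=
  (mul_nonneg h.pos.le (dotProduct_self_nonneg' _)).trans (h.normSq_inv_mulVec_le v)

theorem normSq_col_eq (s : ι) :
    (B⁻¹ *ᵥ Pi.single s 1) ⬝ᵥ (B⁻¹ *ᵥ Pi.single s 1) = ∑ u, (B⁻¹ u s) ^ 2 := by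
  simp [dotProduct, pow_two]

theorem normSq_col_le (h : BoundedBelow t B) (s : ι) : t * ∑ u, (B⁻¹ u s) ^ 2 ≤ B⁻¹ s s := by
  have := h.normSq_inv_mulVec_le (Pi.single s 1)
  rw [normSq_col_eq] at this
  simpa using this

theorem inv_diag_nonneg (h : BoundedBelow t B) (s : ι) : 0 ≤ B⁻¹ s s :=
  (mul_nonneg h.pos.le (Finset.sum_nonneg fun _ _ => sq_nonneg _)).trans (h.normSq_col_le s)

/-- The diagonal entry `r` is one entry of its column, so `t r² ≤ r` by `normSq_col_le`. -/
theorem inv_diag_le (h : BoundedBelow t B) (s : ι) : B⁻¹ s s ≤ 1 / t := by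
  have h1 := h.normSq_col_le s
  have h2 : (B⁻¹ s s) ^ 2 ≤ ∑ u, (B⁻¹ u s) ^ 2 :=
    Finset.single_le_sum (f := fun u => (B⁻¹ u s) ^ 2) (fun _ _ => sq_nonneg _)
      (Finset.mem_univ s)
  rw [le_div_iff₀ h.pos]
  have h0 := h.pos
  rcases (h.inv_diag_nonneg s).eq_or_lt with h3 | h3
  · rw [← h3]; simp
  · have : t * (B⁻¹ s s) ^ 2 ≤ B⁻¹ s s := (mul_le_mul_of_nonneg_left h2 h0.le).trans h1
    by_contra! h4
    nlinarith

/-- Together with `inv_diag_le` this lets `quadForm_variance_le` be applied to a resolvent with `K =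
1 / t`, without operator norms. -/
theorem sum_sq_row_le (h : BoundedBelow t B) (s : ι) : ∑ u, (B⁻¹ s u) ^ 2 ≤ (1 / t) ^ 2 := by
  have h1 := h.normSq_col_le s
  have h2 := h.inv_diag_le s
  have h3 : ∑ u, (B⁻¹ s u) ^ 2 = ∑ u, (B⁻¹ u s) ^ 2 := by
    refine Finset.sum_congr rfl fun u _ => ?_
    conv_lhs => rw [← h.inv_transpose]
    rfl
  rw [h3, pow_two, ← div_eq_mul_one_div, le_div_iff₀ h.pos]
  linarith

theorem trace_inv_nonneg (h : BoundedBelow t B) : 0 ≤ (B⁻¹).trace :=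
  Finset.sum_nonneg fun s _ => h.inv_diag_nonneg s

theorem trace_inv_le (h : BoundedBelow t B) : (B⁻¹).trace ≤ Fintype.card ι / t := by
  calc (B⁻¹).trace ≤ ∑ _s : ι, 1 / t := Finset.sum_le_sum fun s _ => h.inv_diag_le s
    _ = _ := by simp [div_eq_mul_inv]

theorem add_vecMulVec (h : BoundedBelow t B) {a : ℝ} (ha : 0 ≤ a) (v : ι → ℝ) :
    BoundedBelow t (B + a • vecMulVec v v) where
  pos := h.pos
  symm := by
    rw [transpose_add, h.symm, transpose_smul, transpose_vecMulVec]
  le u := by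
    have := h.le u
    rw [add_mulVec, dotProduct_add, smul_mulVec, dotProduct_smul, vecMulVec_mulVec]
    simp only [dotProduct_smul, MulOpposite.smul_eq_mul_unop, MulOpposite.unop_op, smul_eq_mul,
      dotProduct_comm v u]
    nlinarith [mul_nonneg ha (mul_self_nonneg (u ⬝ᵥ v))]

/-- Sherman–Morrison, applied to the perturbing vector. -/
theorem inv_add_mulVec (h : BoundedBelow t B) {a : ℝ} (ha : 0 ≤ a) (v : ι → ℝ) :
    (1 + a * (v ⬝ᵥ (B⁻¹ *ᵥ v))) • ((B + a • vecMulVec v v)⁻¹ *ᵥ v) = B⁻¹ *ᵥ v := by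
  have hA := h.add_vecMulVec ha v
  rw [← mulVec_smul]
  conv_rhs => rw [← hA.inv_mulVec_mulVec (B⁻¹ *ᵥ v)]
  congr 1
  rw [add_mulVec, h.mulVec_inv_mulVec, smul_mulVec, vecMulVec_mulVec]
  ext i
  simp
  ring

theorem quadForm_inv_add (h : BoundedBelow t B) {a : ℝ} (ha : 0 ≤ a) (v : ι → ℝ) :
    a * (v ⬝ᵥ ((B + a • vecMulVec v v)⁻¹ *ᵥ v)) = 1 - 1 / (1 + a * (v ⬝ᵥ (B⁻¹ *ᵥ v))) := by
  have h1 := congrArg (fun w => v ⬝ᵥ w) (h.inv_add_mulVec ha v)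
  simp only [dotProduct_smul, smul_eq_mul] at h1
  have h2 := mul_nonneg ha (h.quadForm_inv_nonneg v)
  have h3 : 1 + a * (v ⬝ᵥ (B⁻¹ *ᵥ v)) ≠ 0 := by positivity
  field_simp
  linear_combination a * h1

/-- Take the trace of `B⁻¹ - A⁻¹ = a A⁻¹ v vᵀ B⁻¹`, with `A` the perturbed matrix, and eliminate
`A⁻¹ v` by Sherman–Morrison. -/
theorem trace_inv_sub (h : BoundedBelow t B) {a : ℝ} (ha : 0 ≤ a) (v : ι → ℝ) :
    (1 + a * (v ⬝ᵥ (B⁻¹ *ᵥ v))) * ((B⁻¹).trace - ((B + a • vecMulVec v v)⁻¹).trace) =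
      a * ((B⁻¹ *ᵥ v) ⬝ᵥ (B⁻¹ *ᵥ v)) := by
  have hA := h.add_vecMulVec ha v
  set A := B + a • vecMulVec v v with hAdef
  have h1 : B⁻¹ - A⁻¹ = a • (A⁻¹ * vecMulVec v v * B⁻¹) := by
    have : a • vecMulVec v v = A - B := by simp [hAdef]
    rw [← smul_mul_assoc, ← mul_smul_comm, this, mul_sub, sub_mul,
      nonsing_inv_mul _ hA.isUnit_det, mul_assoc, mul_nonsing_inv _ h.isUnit_det]
    simp
  have h2 : (A⁻¹ * vecMulVec v v * B⁻¹).trace = (A⁻¹ *ᵥ v) ⬝ᵥ (B⁻¹ *ᵥ v) := by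
    rw [mul_vecMulVec, vecMulVec_mul, trace_vecMulVec, ← mulVec_transpose, h.inv_transpose]
  rw [← trace_sub, h1, trace_smul, h2, smul_eq_mul, mul_left_comm]
  congr 1
  rw [← smul_eq_mul, ← smul_dotProduct, h.inv_add_mulVec ha v]

theorem trace_inv_sub_nonneg (h : BoundedBelow t B) {a : ℝ} (ha : 0 ≤ a) (v : ι → ℝ) :
    0 ≤ (B⁻¹).trace - ((B + a • vecMulVec v v)⁻¹).trace := by
  have h1 := h.trace_inv_sub ha v
  have h2 := mul_nonneg ha (h.quadForm_inv_nonneg v)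
  have h3 := mul_nonneg ha (dotProduct_self_nonneg' (B⁻¹ *ᵥ v))
  rw [← h1] at h3
  exact nonneg_of_mul_nonneg_right h3 (by positivity)

/-- By `normSq_inv_mulVec_le` the difference is at most `t⁻¹ q / (1 + q)` with `q = a vᵀ B⁻¹ v`. The
bound does not depend on `v`, so no control of the length of a column is needed. -/
theorem trace_inv_sub_le (h : BoundedBelow t B) {a : ℝ} (ha : 0 ≤ a) (v : ι → ℝ) :
    (B⁻¹).trace - ((B + a • vecMulVec v v)⁻¹).trace ≤ 1 / t := by
  have h1 := h.trace_inv_sub ha v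
  have h2 := mul_nonneg ha (h.quadForm_inv_nonneg v)
  have h3 := mul_le_mul_of_nonneg_left (h.normSq_inv_mulVec_le v) ha
  have h0 := h.pos
  rw [le_div_iff₀ h0]
  set q := a * (v ⬝ᵥ (B⁻¹ *ᵥ v))
  set D := (B⁻¹).trace - ((B + a • vecMulVec v v)⁻¹).trace
  have h4 : (1 + q) * (D * t) ≤ q := by linear_combination t * h1 + h3
  by_contra! h5
  nlinarith

end BoundedBelow

/-! ### Resolvents of sample covariance matrices and the leave-one-out identity. -/

section Resolvent

variable {p : ℕ}

/-- `z zᵀ` summed over the columns in a finite set, normalised, plus `t`. -/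
def shiftedCov (t : ℝ) (J : Finset (Fin p)) (z : Fin p → ι → ℝ) : Matrix ι ι ℝ :=
  t • (1 : Matrix ι ι ℝ) + ∑ j ∈ J, (1 / (p : ℝ)) • vecMulVec (z j) (z j)

theorem shiftedCov_boundedBelow {t : ℝ} (ht : 0 < t) (J : Finset (Fin p)) (z : Fin p → ι → ℝ) :
    BoundedBelow t (shiftedCov t J z) := by
  classical
  unfold shiftedCov
  induction J using Finset.induction_on with
  | empty =>
    refine ⟨ht, by simp, fun u => ?_⟩
    simp [smul_mulVec]
  | insert j J hj ih =>
    rw [Finset.sum_insert hj, add_comm (_ • vecMulVec _ _), ← add_assoc]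
    exact ih.add_vecMulVec (by positivity) _

theorem shiftedCov_univ_eq (t : ℝ) (j : Fin p) (z : Fin p → ι → ℝ) :
    shiftedCov t Finset.univ z =
      shiftedCov t (Finset.univ.erase j) z + (1 / (p : ℝ)) • vecMulVec (z j) (z j) := by
  unfold shiftedCov
  rw [add_assoc, Finset.sum_erase_add _ _ (Finset.mem_univ j)]

theorem shiftedCov_erase_update (t : ℝ) (j : Fin p) (z : Fin p → ι → ℝ) (w : ι → ℝ) :
    shiftedCov t (Finset.univ.erase j) (Function.update z j w) =
      shiftedCov t (Finset.univ.erase j) z := by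
  unfold shiftedCov
  congr 1
  refine Finset.sum_congr rfl fun i hi => ?_
  rw [Function.update_of_ne (Finset.ne_of_mem_erase hi)]

theorem shiftedCov_univ_eq_sampleCov (t : ℝ) (Z : Matrix ι (Fin p) ℝ) :
    shiftedCov t Finset.univ (fun j s => Z s j) = t • (1 : Matrix ι ι ℝ) + sampleCov Z := by
  unfold shiftedCov sampleCov
  congr 1
  ext i k
  simp [Matrix.sum_apply, vecMulVec_apply, mul_apply, Finset.mul_sum]

theorem continuous_shiftedCov (t : ℝ) (J : Finset (Fin p)) :
    Continuous fun z : Fin p → ι → ℝ => shiftedCov t J z := by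
  unfold shiftedCov
  refine continuous_const.add (continuous_finsetSum _ fun j _ => ?_)
  have h : Continuous fun z : Fin p → ι → ℝ => vecMulVec (z j) (z j) :=
    (continuous_apply j).matrix_vecMulVec (continuous_apply j)
  exact h.const_smul (1 / (p : ℝ))

theorem continuous_inv_shiftedCov {t : ℝ} (ht : 0 < t) (J : Finset (Fin p)) :
    Continuous fun z : Fin p → ι → ℝ => (shiftedCov t J z)⁻¹ := by
  simp only [Matrix.inv_def, Ring.inverse_eq_inv']
  have h := continuous_shiftedCov (ι := ι) t J
  exact (h.matrix_det.inv₀ fun z => (shiftedCov_boundedBelow ht J z).isUnit_det.ne_zero).smul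
    h.matrix_adjugate

/-- The normalised trace of the resolvent, at the point `-t`. -/
def resolventTrace (t : ℝ) (z : Fin p → ι → ℝ) : ℝ :=
  ((shiftedCov t Finset.univ z)⁻¹).trace / Fintype.card ι

theorem continuous_resolventTrace {t : ℝ} (ht : 0 < t) :
    Continuous fun z : Fin p → ι → ℝ => resolventTrace t z :=
  (continuous_inv_shiftedCov ht _).matrix_trace.div_const _

theorem resolventTrace_nonneg {t : ℝ} (ht : 0 < t) (z : Fin p → ι → ℝ) :
    0 ≤ resolventTrace t z :=
  div_nonneg (shiftedCov_boundedBelow ht _ z).trace_inv_nonneg (by positivity)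

theorem resolventTrace_le {t : ℝ} (ht : 0 < t) (z : Fin p → ι → ℝ) :
    resolventTrace t z ≤ 1 / t := by
  unfold resolventTrace
  have := (shiftedCov_boundedBelow ht Finset.univ z).trace_inv_le
  rcases (Nat.cast_nonneg (α := ℝ) (Fintype.card ι)).eq_or_lt with h | h
  · rw [← h, div_zero]; positivity
  · rw [div_le_iff₀ h]; linarith [this, one_div_mul_eq_div t (Fintype.card ι : ℝ)]

theorem trace_erase_sub_bounds {t : ℝ} (ht : 0 < t) (j : Fin p) (z : Fin p → ι → ℝ) :
    0 ≤ ((shiftedCov t (Finset.univ.erase j) z)⁻¹).trace -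
        ((shiftedCov t Finset.univ z)⁻¹).trace ∧
      ((shiftedCov t (Finset.univ.erase j) z)⁻¹).trace -
        ((shiftedCov t Finset.univ z)⁻¹).trace ≤ 1 / t := by
  have h := shiftedCov_boundedBelow ht (Finset.univ.erase j) z
  rw [shiftedCov_univ_eq t j z]
  exact ⟨h.trace_inv_sub_nonneg (by positivity) _, h.trace_inv_sub_le (by positivity) _⟩

/-- Both configurations have the same leave-one-out resolvent, and each unnormalised trace lies
within `1 / t` below its trace. -/
theorem abs_resolventTrace_sub_update_le {t : ℝ} (ht : 0 < t) (j : Fin p) (z : Fin p → ι → ℝ)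
    (w : ι → ℝ) :
    |resolventTrace t z - resolventTrace t (Function.update z j w)| ≤
      1 / t / Fintype.card ι := by
  have h1 := trace_erase_sub_bounds ht j z
  have h2 := trace_erase_sub_bounds ht j (Function.update z j w)
  rw [shiftedCov_erase_update] at h2
  unfold resolventTrace
  rw [← sub_div, abs_div, Nat.abs_cast]
  gcongr
  rw [abs_le]
  constructor <;> linarith [h1.1, h1.2, h2.1, h2.2]

/-- The leave-one-out quadratic form `p⁻¹ zⱼᵀ R⁽ʲ⁾ zⱼ`. -/
def leaveOneOut (t : ℝ) (j : Fin p) (z : Fin p → ι → ℝ) : ℝ :=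
  (1 / (p : ℝ)) * (z j ⬝ᵥ ((shiftedCov t (Finset.univ.erase j) z)⁻¹ *ᵥ z j))

theorem leaveOneOut_nonneg {t : ℝ} (ht : 0 < t) (j : Fin p) (z : Fin p → ι → ℝ) :
    0 ≤ leaveOneOut t j z :=
  mul_nonneg (by positivity) ((shiftedCov_boundedBelow ht _ z).quadForm_inv_nonneg _)

theorem continuous_leaveOneOut {t : ℝ} (ht : 0 < t) (j : Fin p) :
    Continuous fun z : Fin p → ι → ℝ => leaveOneOut t j z := by
  have h : Continuous fun z : Fin p → ι → ℝ => z j := continuous_apply j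
  exact continuous_const.mul (h.dotProduct ((continuous_inv_shiftedCov ht _).matrix_mulVec h))

/-- The resolvent identity `N - t tr R = ∑ⱼ (1 - 1 / (1 + qⱼ))`. -/
theorem card_sub_trace_eq {t : ℝ} (ht : 0 < t) (z : Fin p → ι → ℝ) :
    Fintype.card ι - t * ((shiftedCov t Finset.univ z)⁻¹).trace =
      ∑ j, (1 - 1 / (1 + leaveOneOut t j z)) := by
  have hB := shiftedCov_boundedBelow ht Finset.univ z
  -- Each summand is `p⁻¹ zⱼᵀ R zⱼ` with the full resolvent; together they form `tr ((R⁻¹ - t) R)`.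
  have h1 : ∀ j, 1 - 1 / (1 + leaveOneOut t j z) =
      (((1 / (p : ℝ)) • vecMulVec (z j) (z j)) * (shiftedCov t Finset.univ z)⁻¹).trace := by
    intro j
    rw [smul_mul_assoc, trace_smul, vecMulVec_mul, trace_vecMulVec, ← mulVec_transpose,
      hB.inv_transpose, smul_eq_mul, shiftedCov_univ_eq t j z]
    exact ((shiftedCov_boundedBelow ht _ z).quadForm_inv_add (by positivity) (z j)).symm
  simp only [h1]
  rw [← trace_sum, ← Finset.sum_mul]
  have h2 : ∑ j, (1 / (p : ℝ)) • vecMulVec (z j) (z j) =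
      shiftedCov t Finset.univ z - t • (1 : Matrix ι ι ℝ) := by
    simp [shiftedCov]
  rw [h2, sub_mul, mul_nonsing_inv _ hB.isUnit_det, trace_sub, trace_one]
  simp

theorem trace_inv_smul_one_add {A : Matrix ι ι ℝ} (hA : A.IsHermitian) {t : ℝ}
    (h : ∀ i, hA.eigenvalues i + t ≠ 0) :
    ((t • (1 : Matrix ι ι ℝ) + A)⁻¹).trace = ∑ i, 1 / (hA.eigenvalues i + t) := by
  set U : Matrix ι ι ℝ := (hA.eigenvectorUnitary : Matrix ι ι ℝ)
  have hU : U * star U = 1 := Unitary.coe_mul_star_self hA.eigenvectorUnitary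
  have hU' : star U * U = 1 := Unitary.coe_star_mul_self hA.eigenvectorUnitary
  have hspec : A = U * diagonal hA.eigenvalues * star U := by
    have := hA.spectral_theorem
    simpa [Unitary.conjStarAlgAut_apply] using this
  have key : (t • (1 : Matrix ι ι ℝ) + A)⁻¹ =
      U * diagonal (fun i => 1 / (hA.eigenvalues i + t)) * star U := by
    apply inv_eq_right_inv
    have e1 : t • (1 : Matrix ι ι ℝ) + A =
        U * diagonal (fun i => hA.eigenvalues i + t) * star U := by
      have : diagonal (fun i => hA.eigenvalues i + t) =
          diagonal hA.eigenvalues + t • (1 : Matrix ι ι ℝ) := by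
        ext i j
        by_cases hij : i = j <;> simp [hij, diagonal, one_apply]
      rw [this, mul_add, add_mul, ← hspec, mul_smul_comm, smul_mul_assoc, mul_one, hU, add_comm]
    rw [e1]
    calc U * diagonal (fun i => hA.eigenvalues i + t) * star U *
          (U * diagonal (fun i => 1 / (hA.eigenvalues i + t)) * star U)
        = U * diagonal (fun i => hA.eigenvalues i + t) * (star U * U) *
          diagonal (fun i => 1 / (hA.eigenvalues i + t)) * star U := by
          simp only [mul_assoc]
      _ = U * (diagonal (fun i => hA.eigenvalues i + t) *
          diagonal (fun i => 1 / (hA.eigenvalues i + t))) * star U := by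
          rw [hU', mul_one]; simp only [mul_assoc]
      _ = 1 := by
          rw [diagonal_mul_diagonal]
          simp only [mul_one_div_cancel (h _)]
          rw [diagonal_one, mul_one, hU]
  rw [key, trace_mul_comm, ← mul_assoc, hU', one_mul, trace_diagonal]

theorem eigenvalues_sampleCov_nonneg (Z : Matrix ι (Fin p) ℝ) (i : ι) :
    0 ≤ (sampleCov_isHermitian Z).eigenvalues i := by
  refine PosSemidef.eigenvalues_nonneg (A := sampleCov Z) ?_ i
  unfold sampleCov
  have := posSemidef_self_mul_conjTranspose Z
  rw [conjTranspose_eq_transpose_of_trivial] at this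
  exact this.smul (by positivity)

theorem resolventTrace_eq_sum {t : ℝ} (ht : 0 < t) (Z : Matrix ι (Fin p) ℝ) :
    resolventTrace t (fun j s => Z s j) =
      (1 / (Fintype.card ι : ℝ)) *
        ∑ i, 1 / ((sampleCov_isHermitian Z).eigenvalues i + t) := by
  unfold resolventTrace
  rw [shiftedCov_univ_eq_sampleCov, trace_inv_smul_one_add (sampleCov_isHermitian Z)]
  · ring
  · intro i
    have := eigenvalues_sampleCov_nonneg Z i
    positivity

end Resolvent

end LinearAlgebra


/-! ### Intersections of a random `d`-subset with a fixed set. -/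

section Counting

theorem card_tensorIndex (n d : ℕ) : Fintype.card (TensorIndex n d) = n.choose d := by
  rw [Fintype.card_finset_len, Fintype.card_fin]

/-- The ratio of the two binomials is the product of `(d - i) / (n - i)` over `i < k`, and each
factor is at most `d / n`. -/
theorem choose_sub_sub_le {n d k : ℕ} (hkd : k ≤ d) (hdn : d ≤ n) :
    ((n - k).choose (d - k) : ℝ) ≤ n.choose d * ((d : ℝ) / n) ^ k := by
  induction k with
  | zero => simp
  | succ k ih =>
    have h1 := ih (by omega)
    have h2 := Nat.add_one_mul_choose_eq (n - (k + 1)) (d - (k + 1))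
    rw [show n - (k + 1) + 1 = n - k by omega, show d - (k + 1) + 1 = d - k by omega] at h2
    have h3 : ((n - k : ℕ) : ℝ) * ((n - (k + 1)).choose (d - (k + 1)) : ℝ) =
        ((n - k).choose (d - k) : ℝ) * ((d - k : ℕ) : ℝ) := by exact_mod_cast h2
    rw [Nat.cast_sub (by omega), Nat.cast_sub (by omega)] at h3
    have hk : (k : ℝ) < n := by exact_mod_cast (by omega : k < n)
    have hdn' : (d : ℝ) ≤ n := by exact_mod_cast hdn
    have hn : (0 : ℝ) < n := by linarith [Nat.cast_nonneg (α := ℝ) k]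
    have h4 : ((d : ℝ) - k) / (n - k) ≤ d / n := by
      rw [div_le_div_iff₀ (by linarith) hn]
      nlinarith [mul_nonneg (Nat.cast_nonneg (α := ℝ) k) (sub_nonneg.2 hdn')]
    have h5 : ((n - (k + 1)).choose (d - (k + 1)) : ℝ) =
        (n - k).choose (d - k) * (((d : ℝ) - k) / (n - k)) := by
      rw [mul_div_assoc', eq_div_iff (by linarith), ← h3, mul_comm]
    rw [h5, pow_succ, ← mul_assoc]
    have : (0 : ℝ) ≤ (d : ℝ) / n := by positivity
    calc _ ≤ ((n - k).choose (d - k) : ℝ) * (d / n) := by gcongr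
      _ ≤ _ := by gcongr

/-- The proportion of `d`-subsets that contain a given set `T` is at most `(d / n) ^ #T`. -/
theorem card_superset_le {n d : ℕ} (T : Finset (Fin n)) :
    (((Finset.univ : Finset (TensorIndex n d)).filter fun u => T ⊆ u.1).card : ℝ) ≤
      n.choose d * ((d : ℝ) / n) ^ T.card := by
  have h1 : ((Finset.univ : Finset (TensorIndex n d)).filter fun u => T ⊆ u.1).card ≤
      (((Finset.univ : Finset (Fin n)).powersetCard d).filter (T ⊆ ·)).card := by
    refine Finset.card_le_card_of_injOn (fun u => u.1) ?_ Subtype.val_injective.injOn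
    intro u hu
    have := u.2
    simp_all
  by_cases hT : T.card ≤ d
  · rw [Finset.card_filter_powersetCard_subset _ _ _ (Finset.subset_univ T) hT,
      Finset.card_univ, Fintype.card_fin] at h1
    by_cases hdn : d ≤ n
    · exact (Nat.cast_le.2 h1).trans (choose_sub_sub_le hT hdn)
    · have hTn : T.card ≤ n := T.card_le_univ.trans_eq (Fintype.card_fin n)
      rw [Nat.choose_eq_zero_of_lt (by omega)] at h1
      rw [Nat.le_zero.1 h1, Nat.cast_zero]
      positivity
  · rw [Finset.filter_false_of_mem]
    · simp only [Finset.card_empty, Nat.cast_zero]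
      positivity
    · intro u _ hTu
      exact hT ((Finset.card_le_card hTu).trans u.2.le)

/-- Expand `M ^ #(u ∩ W)` as the sum of `(M - 1) ^ #T` over `T ⊆ u ∩ W`, count the `u` containing
`T`, and resum by the binomial theorem. Subtracting `1` discards the `u` that miss `W`, so that the
bound is `o(N)` when `M d #W ≪ n`. -/
theorem sum_pow_card_inter_le {n d : ℕ} {M : ℝ} (hM : 1 ≤ M) (W : Finset (Fin n)) :
    ∑ u : TensorIndex n d, (M ^ (u.1 ∩ W).card - 1) ≤
      n.choose d * (Real.exp (M * d * W.card / n) - 1) := by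
  have h1 : ∀ u : TensorIndex n d, M ^ (u.1 ∩ W).card =
      ∑ T ∈ W.powerset, if T ⊆ u.1 then (M - 1) ^ T.card else 0 := by
    intro u
    have h2 := Finset.sum_pow_mul_eq_add_pow (M - 1) 1 (u.1 ∩ W)
    simp only [one_pow, mul_one, sub_add_cancel] at h2
    rw [← h2, ← Finset.sum_filter]
    refine Finset.sum_congr ?_ fun _ _ => rfl
    ext T
    rw [Finset.mem_powerset, Finset.mem_filter, Finset.mem_powerset, Finset.subset_inter_iff,
      and_comm]
  have h3 : ∑ u : TensorIndex n d, M ^ (u.1 ∩ W).card ≤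
      n.choose d * (1 + (M - 1) * (d / n)) ^ W.card := by
    simp only [h1]
    rw [Finset.sum_comm]
    have h4 := Finset.sum_pow_mul_eq_add_pow ((M - 1) * ((d : ℝ) / n)) 1 W
    simp only [one_pow, mul_one] at h4
    rw [add_comm (1 : ℝ), ← h4, Finset.mul_sum]
    refine Finset.sum_le_sum fun T _ => ?_
    rw [← Finset.sum_filter, Finset.sum_const, nsmul_eq_mul, mul_pow, mul_left_comm, mul_comm]
    exact mul_le_mul_of_nonneg_left (card_superset_le T)
      (pow_nonneg (by linarith) _)
  have h5 : (1 + (M - 1) * ((d : ℝ) / n)) ^ W.card ≤ Real.exp (M * d * W.card / n) := by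
    have h6 : 1 + (M - 1) * ((d : ℝ) / n) ≤ Real.exp (M * (d / n)) := by
      have := Real.add_one_le_exp (M * ((d : ℝ) / n))
      have : 0 ≤ (d : ℝ) / n := by positivity
      linarith
    have h7 : 0 ≤ (M - 1) * ((d : ℝ) / n) := mul_nonneg (by linarith) (by positivity)
    calc _ ≤ (Real.exp (M * (d / n))) ^ W.card := pow_le_pow_left₀ (by linarith) h6 _
      _ = _ := by rw [← Real.exp_nat_mul]; congr 1; ring
  rw [Finset.sum_sub_distrib]
  simp only [Finset.sum_const, Finset.card_univ, card_tensorIndex, nsmul_eq_mul, mul_one]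
  have := mul_le_mul_of_nonneg_left h5 (Nat.cast_nonneg (α := ℝ) (n.choose d))
  linarith

end Counting

/-! ### Mixed moments of four tensor entries. -/

section Moments

variable {n : ℕ} (μ : Measure ℝ) [IsProbabilityMeasure μ]

/-- The mixed moment of four products `∏_{i ∈ s} xᵢ`. -/
def mixedMoment (s t u v : Finset (Fin n)) : ℝ :=
  ∫ x, (∏ i ∈ s, x i) * (∏ i ∈ t, x i) * (∏ i ∈ u, x i) * (∏ i ∈ v, x i)
    ∂(Measure.pi fun _ : Fin n => μ)

/-- The number of the sets `s`, `t`, `u`, `v` that contain `i`. -/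
def multiplicity (s t u v : Finset (Fin n)) (i : Fin n) : ℕ :=
  (if i ∈ s then 1 else 0) + (if i ∈ t then 1 else 0) + (if i ∈ u then 1 else 0) +
    (if i ∈ v then 1 else 0)

theorem prod_eq_prod_pow (s t u v : Finset (Fin n)) (x : Fin n → ℝ) :
    (∏ i ∈ s, x i) * (∏ i ∈ t, x i) * (∏ i ∈ u, x i) * (∏ i ∈ v, x i) =
      ∏ i, x i ^ multiplicity s t u v i := by
  have h : ∀ s : Finset (Fin n), ∏ i ∈ s, x i = ∏ i, x i ^ (if i ∈ s then 1 else 0) := by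
    intro s
    simp [pow_ite, Finset.prod_ite_mem]
  simp only [multiplicity, pow_add, Finset.prod_mul_distrib, ← h]

variable {μ}

theorem integrable_pow_of_even (hint : ∀ k : ℕ, Integrable (fun t : ℝ => t ^ (2 * k)) μ) (k : ℕ) :
    Integrable (fun t : ℝ => t ^ k) μ := by
  refine ((integrable_const (1 : ℝ)).add (hint k)).mono' (by fun_prop) (ae_of_all _ fun t => ?_)
  simp only [Pi.add_apply, norm_pow, Real.norm_eq_abs, pow_mul' t, ← sq_abs (t ^ k), abs_pow]
  nlinarith [sq_nonneg (|t| ^ k - 1), pow_nonneg (abs_nonneg t) k]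

theorem integral_pow_odd (hsymm : μ.map (fun t => -t) = μ) {k : ℕ} (hk : Odd k) :
    ∫ t, t ^ k ∂μ = 0 := by
  have h : ∫ t, t ^ k ∂μ = ∫ t, (-t) ^ k ∂μ := by
    conv_lhs => rw [← hsymm]
    rw [integral_map (by fun_prop) (by fun_prop)]
  simp only [hk.neg_pow, integral_neg] at h
  linarith

theorem mixedMoment_eq (s t u v : Finset (Fin n)) :
    mixedMoment μ s t u v = ∏ i, ∫ y, y ^ multiplicity s t u v i ∂μ := by
  unfold mixedMoment
  simp only [prod_eq_prod_pow]
  rw [integral_fintype_prod_eq_prod (fun i (y : ℝ) => y ^ multiplicity s t u v i)]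

theorem integrable_prod_four (hint : ∀ k : ℕ, Integrable (fun t : ℝ => t ^ (2 * k)) μ)
    (s t u v : Finset (Fin n)) :
    Integrable (fun x : Fin n → ℝ =>
      (∏ i ∈ s, x i) * (∏ i ∈ t, x i) * (∏ i ∈ u, x i) * (∏ i ∈ v, x i))
      (Measure.pi fun _ : Fin n => μ) := by
  simp only [prod_eq_prod_pow]
  exact Integrable.fintype_prod (f := fun i (y : ℝ) => y ^ multiplicity s t u v i)
    fun i => integrable_pow_of_even hint _

theorem multiplicity_le (s t u v : Finset (Fin n)) (i : Fin n) : multiplicity s t u v i ≤ 4 := by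
  unfold multiplicity
  split_ifs <;> omega

/-- A probability measure on `ℝ` which is symmetric, has unit variance, all of whose moments are
finite, and whose fourth moment is at most `M`. -/
structure IsEntryLaw (μ : Measure ℝ) (M : ℝ) : Prop where
  symm : μ.map (fun t => -t) = μ
  integrable : ∀ k : ℕ, Integrable (fun t : ℝ => t ^ (2 * k)) μ
  variance : ∫ t, t ^ 2 ∂μ = 1
  fourth : ∫ t, t ^ 4 ∂μ ≤ M
  two_le : 2 ≤ M

variable {M : ℝ}

theorem IsEntryLaw.integral_pow (h : IsEntryLaw μ M) {k : ℕ} (hk : k ≤ 4) :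
    ∫ y, y ^ k ∂μ = if k = 0 then 1 else if k = 2 then 1 else if k = 4 then ∫ t, t ^ 4 ∂μ
      else 0 := by
  interval_cases k
  · simp
  · simpa using integral_pow_odd h.symm (k := 1) (by decide)
  · simpa using h.variance
  · simpa using integral_pow_odd h.symm (k := 3) (by decide)
  · simp

theorem IsEntryLaw.fourth_nonneg (_h : IsEntryLaw μ M) : 0 ≤ ∫ t, t ^ 4 ∂μ :=
  integral_nonneg fun t => by positivity

theorem IsEntryLaw.integral_pow_nonneg (h : IsEntryLaw μ M) {k : ℕ} (hk : k ≤ 4) :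
    0 ≤ ∫ y, y ^ k ∂μ := by
  have := h.fourth_nonneg
  rw [h.integral_pow hk]
  split_ifs <;> first | exact this | norm_num

theorem IsEntryLaw.mixedMoment_nonneg (h : IsEntryLaw μ M) (s t u v : Finset (Fin n)) :
    0 ≤ mixedMoment μ s t u v := by
  rw [mixedMoment_eq]
  exact Finset.prod_nonneg fun i _ => h.integral_pow_nonneg (multiplicity_le _ _ _ _ _)

theorem IsEntryLaw.mixedMoment_pair (h : IsEntryLaw μ M) (s u : Finset (Fin n)) :
    mixedMoment μ s s u u = (∫ t, t ^ 4 ∂μ) ^ (u ∩ s).card := by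
  rw [mixedMoment_eq, ← Finset.prod_const, ← Finset.prod_subset (Finset.subset_univ (u ∩ s))]
  · refine Finset.prod_congr rfl fun i hi => ?_
    rw [Finset.mem_inter] at hi
    simp [multiplicity, hi.1, hi.2]
  · intro i _ hi
    rw [h.integral_pow (multiplicity_le _ _ _ _ _)]
    rw [Finset.mem_inter] at hi
    by_cases h1 : i ∈ s <;> by_cases h2 : i ∈ u <;> simp_all [multiplicity]

theorem IsEntryLaw.mixedMoment_le (h : IsEntryLaw μ M) (s t u v : Finset (Fin n)) :
    mixedMoment μ s t u v ≤ M ^ (u ∩ (s ∩ t)).card := by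
  have h1 : M ^ (u ∩ (s ∩ t)).card = ∏ i, if i ∈ u ∩ (s ∩ t) then M else 1 := by
    rw [Finset.prod_ite_mem, Finset.univ_inter, Finset.prod_const]
  have hM := h.two_le
  have hM' := h.fourth
  rw [mixedMoment_eq, h1]
  refine Finset.prod_le_prod (fun i _ => h.integral_pow_nonneg (multiplicity_le _ _ _ _ _))
    fun i _ => ?_
  rw [h.integral_pow (multiplicity_le _ _ _ _ _)]
  by_cases h1 : i ∈ s <;> by_cases h2 : i ∈ u <;> by_cases h3 : i ∈ t <;>
    by_cases h4 : i ∈ v <;> simp [multiplicity, h1, h2, h3, h4] <;> linarith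

/-- Odd moments vanish, so every multiplicity is even; hence `v` is the symmetric difference of `s`,
`t` and `u`, and is determined by them. -/
theorem IsEntryLaw.mem_iff_of_mixedMoment_ne_zero (h : IsEntryLaw μ M)
    {s t u v : Finset (Fin n)} (h0 : mixedMoment μ s t u v ≠ 0) (i : Fin n) :
    i ∈ v ↔ ((i ∈ u) ↔ ((i ∈ s) ↔ (i ∈ t))) := by
  rw [mixedMoment_eq, Finset.prod_ne_zero_iff] at h0
  have h1 := h0 i (Finset.mem_univ i)
  rw [h.integral_pow (multiplicity_le _ _ _ _ _)] at h1
  unfold multiplicity at h1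
  by_cases h1 : i ∈ s <;> by_cases h2 : i ∈ u <;> by_cases h3 : i ∈ t <;>
    by_cases h4 : i ∈ v <;> simp_all

/-- At most one `v` contributes, and its moment is at most `M ^ k` with `k = #(u ∩ s ∩ t)`. If it
contributes, `u` must meet the symmetric difference of `s` and `t`, so `#(u ∩ (s ∪ t)) ≥ k + 1`, and
`M ^ k ≤ M ^ (k + 1) - 1` because `M ≥ 2`. The bound has the shape summed in
`sum_pow_card_inter_le`. -/
theorem IsEntryLaw.sum_mixedMoment_le (h : IsEntryLaw μ M) {d : ℕ} {s t : TensorIndex n d}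
    (hst : s ≠ t) (u : TensorIndex n d) :
    ∑ v : TensorIndex n d, mixedMoment μ s.1 t.1 u.1 v.1 ≤ M ^ (u.1 ∩ (s.1 ∪ t.1)).card - 1 := by
  have hM := h.two_le
  by_cases h0 : ∀ v : TensorIndex n d, mixedMoment μ s.1 t.1 u.1 v.1 = 0
  · simp only [h0, Finset.sum_const_zero, sub_nonneg]
    exact one_le_pow₀ (by linarith)
  · push Not at h0
    obtain ⟨v, hv⟩ := h0
    have hmem := h.mem_iff_of_mixedMoment_ne_zero hv
    rw [Finset.sum_eq_single_of_mem v (Finset.mem_univ v)]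
    · refine (h.mixedMoment_le _ _ _ _).trans ?_
      -- Otherwise `u ⊆ v`, hence `u = v` since both have `d` elements, and the parity condition
      -- then gives `s = t`.
      have hex : ∃ i, i ∈ u.1 ∧ ¬ (i ∈ s.1 ↔ i ∈ t.1) := by
        by_contra! hcon
        have huv : u.1 ⊆ v.1 := fun i hi => by
          have := hcon i hi
          rw [hmem]; tauto
        have huv' : u.1 = v.1 := Finset.eq_of_subset_of_card_le huv (by rw [u.2, v.2])
        apply hst
        apply Subtype.ext
        ext i
        have := hmem i
        rw [← huv'] at this
        tauto
      obtain ⟨i, hi, hi'⟩ := hex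
      have hcard : (u.1 ∩ (s.1 ∩ t.1)).card + 1 ≤ (u.1 ∩ (s.1 ∪ t.1)).card := by
        apply Finset.card_lt_card
        rw [Finset.ssubset_iff_of_subset]
        · refine ⟨i, ?_, ?_⟩ <;> simp only [Finset.mem_inter, Finset.mem_union] <;> tauto
        · intro j
          simp only [Finset.mem_inter, Finset.mem_union]
          tauto
      have h1 : M ^ ((u.1 ∩ (s.1 ∩ t.1)).card + 1) ≤ M ^ (u.1 ∩ (s.1 ∪ t.1)).card :=
        pow_le_pow_right₀ (by linarith) hcard
      have h2 : 1 ≤ M ^ (u.1 ∩ (s.1 ∩ t.1)).card := one_le_pow₀ (by linarith)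
      rw [pow_succ] at h1
      nlinarith
    · intro w _ hw
      by_contra hw0
      apply hw
      apply Subtype.ext
      ext i
      rw [hmem i, h.mem_iff_of_mixedMoment_ne_zero hw0 i]

end Moments

/-! ### Concentration of quadratic forms in a random tensor. -/

section QuadraticForm

/-- Schur's test for a symmetric kernel with nonnegative entries. -/
theorem sum_mul_mul_le_of_symm {α : Type*} [Fintype α] {κ : α → α → ℝ} (h0 : ∀ a b, 0 ≤ κ a b)
    (hsymm : ∀ a b, κ a b = κ b a) (f : α → ℝ) :
    ∑ a, ∑ b, f a * f b * κ a b ≤ ∑ a, f a ^ 2 * ∑ b, κ a b := by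
  have h1 : ∑ a, ∑ b, f b ^ 2 * κ a b = ∑ a, ∑ b, f a ^ 2 * κ a b := by
    rw [Finset.sum_comm]
    simp only [hsymm]
  have h2 : ∑ a, ∑ b, 2 * (f a * f b * κ a b) ≤
      ∑ a, ∑ b, (f a ^ 2 * κ a b + f b ^ 2 * κ a b) := by
    refine Finset.sum_le_sum fun a _ => Finset.sum_le_sum fun b _ => ?_
    nlinarith [mul_nonneg (h0 a b) (sq_nonneg (f a - f b))]
  simp only [Finset.sum_add_distrib, ← Finset.mul_sum, h1] at h2
  linarith

variable {n d : ℕ} {μ : Measure ℝ} [IsProbabilityMeasure μ] {M : ℝ}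

theorem mixedMoment_swap (s t u v : Finset (Fin n)) :
    mixedMoment μ s t u v = mixedMoment μ u v s t := by
  unfold mixedMoment
  congr 1
  ext x
  ring

theorem measurable_tensorVector : Measurable (tensorVector n d) := by
  unfold tensorVector
  fun_prop

/-- The relative variance bound for quadratic forms of random tensors. -/
def varianceRate (n d : ℕ) (M : ℝ) : ℝ := Real.exp (2 * M * d ^ 2 / n) - 1

theorem varianceRate_nonneg (hM : 0 ≤ M) : 0 ≤ varianceRate n d M := by
  unfold varianceRate
  rw [sub_nonneg, Real.one_le_exp_iff]
  positivity

theorem sum_pow_card_inter_le_varianceRate (hM : 1 ≤ M) {W : Finset (Fin n)}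
    (hW : W.card ≤ 2 * d) :
    ∑ u : TensorIndex n d, (M ^ (u.1 ∩ W).card - 1) ≤ n.choose d * varianceRate n d M := by
  refine (sum_pow_card_inter_le hM W).trans ?_
  unfold varianceRate
  have hW' : (W.card : ℝ) ≤ 2 * d := by exact_mod_cast hW
  have h1 : M * d * W.card ≤ 2 * M * d ^ 2 := by
    calc M * d * W.card ≤ M * d * (2 * d) := by gcongr
      _ = _ := by ring
  gcongr

/-- The second moment is a quadratic form in the entries of `B` whose kernel, the mixed moment, is
symmetric and nonnegative. Schur's test reduces it to the row sums over `(u, v)`, which are at most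
`N * varianceRate` for every row `(s, t)` with `s ≠ t`; the zero diagonal removes the other rows. -/
theorem IsEntryLaw.offDiag_secondMoment_le (h : IsEntryLaw μ M) {K : ℝ}
    {B : Matrix (TensorIndex n d) (TensorIndex n d) ℝ} (hB : ∀ s, ∑ u, B s u ^ 2 ≤ K ^ 2)
    (hdiag : ∀ s, B s s = 0) :
    Integrable (fun x => (∑ a : TensorIndex n d × TensorIndex n d,
      B a.1 a.2 * (tensorVector n d x a.1 * tensorVector n d x a.2)) ^ 2)
      (Measure.pi fun _ : Fin n => μ) ∧
    ∫ x, (∑ a : TensorIndex n d × TensorIndex n d,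
      B a.1 a.2 * (tensorVector n d x a.1 * tensorVector n d x a.2)) ^ 2
      ∂(Measure.pi fun _ : Fin n => μ) ≤ (n.choose d) ^ 2 * K ^ 2 * varianceRate n d M := by
  have hM := h.two_le
  have hexp : ∀ x : Fin n → ℝ, (∑ a : TensorIndex n d × TensorIndex n d,
      B a.1 a.2 * (tensorVector n d x a.1 * tensorVector n d x a.2)) ^ 2 =
      ∑ a : TensorIndex n d × TensorIndex n d, ∑ b : TensorIndex n d × TensorIndex n d,
        B a.1 a.2 * B b.1 b.2 * ((∏ i ∈ a.1.1, x i) * (∏ i ∈ a.2.1, x i) * (∏ i ∈ b.1.1, x i) *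
          (∏ i ∈ b.2.1, x i)) := by
    intro x
    rw [pow_two, Finset.sum_mul_sum]
    refine Finset.sum_congr rfl fun a _ => Finset.sum_congr rfl fun b _ => ?_
    simp only [tensorVector]
    ring
  simp only [hexp]
  have hi := integrable_prod_four (n := n) h.integrable
  refine ⟨integrable_finsetSum _ fun a _ => integrable_finsetSum _ fun b _ =>
    (hi _ _ _ _).const_mul _, ?_⟩
  rw [integral_finsetSum _ fun a _ => integrable_finsetSum _ fun b _ => (hi _ _ _ _).const_mul _]
  simp only [integral_finsetSum _ fun b _ => (hi _ _ _ _).const_mul _, integral_const_mul]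
  refine (sum_mul_mul_le_of_symm (α := TensorIndex n d × TensorIndex n d)
    (κ := fun a b => mixedMoment μ a.1.1 a.2.1 b.1.1 b.2.1)
    (f := fun a => B a.1 a.2) (fun a b => h.mixedMoment_nonneg _ _ _ _)
    fun a b => mixedMoment_swap _ _ _ _).trans ?_
  have hrow : ∀ a : TensorIndex n d × TensorIndex n d,
      B a.1 a.2 ^ 2 * ∑ b : TensorIndex n d × TensorIndex n d,
        mixedMoment μ a.1.1 a.2.1 b.1.1 b.2.1 ≤
      B a.1 a.2 ^ 2 * (n.choose d * varianceRate n d M) := by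
    rintro ⟨s, t⟩
    by_cases hst : s = t
    · simp [hst, hdiag]
    · refine mul_le_mul_of_nonneg_left ?_ (sq_nonneg _)
      rw [Fintype.sum_prod_type]
      refine (Finset.sum_le_sum fun u _ => h.sum_mixedMoment_le hst u).trans ?_
      refine sum_pow_card_inter_le_varianceRate (by linarith) ?_
      refine (Finset.card_union_le _ _).trans ?_
      rw [s.2, t.2, two_mul]
  refine (Finset.sum_le_sum fun a _ => hrow a).trans ?_
  rw [← Finset.sum_mul, Fintype.sum_prod_type]
  have h1 : ∑ s, ∑ t, B s t ^ 2 ≤ n.choose d * K ^ 2 := by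
    refine (Finset.sum_le_sum fun s _ => hB s).trans_eq ?_
    rw [Finset.sum_const, Finset.card_univ, card_tensorIndex, nsmul_eq_mul]
  have h2 := varianceRate_nonneg (n := n) (d := d) (M := M) (by linarith)
  calc _ ≤ (n.choose d * K ^ 2) * (n.choose d * varianceRate n d M) := by gcongr
    _ = _ := by ring

/-- The covariance of `z_s²` and `z_u²` is `(E x⁴) ^ #(u ∩ s) - 1`, which vanishes for disjoint `s`
and `u`. -/
theorem IsEntryLaw.diag_secondMoment_le (h : IsEntryLaw μ M) {K : ℝ} {a : TensorIndex n d → ℝ}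
    (ha : ∀ s, |a s| ≤ K) :
    Integrable (fun x => (∑ s, a s * (tensorVector n d x s ^ 2 - 1)) ^ 2)
      (Measure.pi fun _ : Fin n => μ) ∧
    ∫ x, (∑ s, a s * (tensorVector n d x s ^ 2 - 1)) ^ 2 ∂(Measure.pi fun _ : Fin n => μ) ≤
      (n.choose d) ^ 2 * K ^ 2 * varianceRate n d M := by
  have hM := h.two_le
  -- The empty products present the lower-order terms as mixed moments too, so `mixedMoment_pair`
  -- evaluates all of them.
  have hexp : ∀ x : Fin n → ℝ, (∑ s, a s * (tensorVector n d x s ^ 2 - 1)) ^ 2 =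
      ∑ s : TensorIndex n d, ∑ u : TensorIndex n d, a s * a u *
        ((∏ i ∈ s.1, x i) * (∏ i ∈ s.1, x i) * (∏ i ∈ u.1, x i) * (∏ i ∈ u.1, x i)
        - (∏ i ∈ s.1, x i) * (∏ i ∈ s.1, x i) * (∏ i ∈ ∅, x i) * (∏ i ∈ ∅, x i)
        - (∏ i ∈ u.1, x i) * (∏ i ∈ u.1, x i) * (∏ i ∈ ∅, x i) * (∏ i ∈ ∅, x i) + 1) := by
    intro x
    rw [pow_two, Finset.sum_mul_sum]
    refine Finset.sum_congr rfl fun s _ => Finset.sum_congr rfl fun u _ => ?_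
    simp only [tensorVector, Finset.prod_empty]
    ring
  simp only [hexp]
  have hi := integrable_prod_four (n := n) h.integrable
  have hi' : ∀ s u : TensorIndex n d, Integrable (fun x : Fin n → ℝ =>
      (∏ i ∈ s.1, x i) * (∏ i ∈ s.1, x i) * (∏ i ∈ u.1, x i) * (∏ i ∈ u.1, x i)
        - (∏ i ∈ s.1, x i) * (∏ i ∈ s.1, x i) * (∏ i ∈ ∅, x i) * (∏ i ∈ ∅, x i)
        - (∏ i ∈ u.1, x i) * (∏ i ∈ u.1, x i) * (∏ i ∈ ∅, x i) * (∏ i ∈ ∅, x i) + 1)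
      (Measure.pi fun _ : Fin n => μ) := fun s u =>
    (((hi _ _ _ _).sub (hi _ _ _ _)).sub (hi _ _ _ _)).add (integrable_const 1)
  have hval : ∀ s u : TensorIndex n d, ∫ x : Fin n → ℝ,
      ((∏ i ∈ s.1, x i) * (∏ i ∈ s.1, x i) * (∏ i ∈ u.1, x i) * (∏ i ∈ u.1, x i)
        - (∏ i ∈ s.1, x i) * (∏ i ∈ s.1, x i) * (∏ i ∈ ∅, x i) * (∏ i ∈ ∅, x i)
        - (∏ i ∈ u.1, x i) * (∏ i ∈ u.1, x i) * (∏ i ∈ ∅, x i) * (∏ i ∈ ∅, x i) + 1)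
      ∂(Measure.pi fun _ : Fin n => μ) = (∫ t, t ^ 4 ∂μ) ^ (u.1 ∩ s.1).card - 1 := by
    intro s u
    rw [integral_add (((hi _ _ _ _).sub' (hi _ _ _ _)).sub' (hi _ _ _ _)) (integrable_const 1),
      integral_sub ((hi _ _ _ _).sub' (hi _ _ _ _)) (hi _ _ _ _),
      integral_sub (hi _ _ _ _) (hi _ _ _ _)]
    change mixedMoment μ _ _ _ _ - mixedMoment μ _ _ _ _ - mixedMoment μ _ _ _ _ + _ = _
    rw [h.mixedMoment_pair, h.mixedMoment_pair, h.mixedMoment_pair]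
    simp
  refine ⟨integrable_finsetSum _ fun a _ => integrable_finsetSum _ fun b _ =>
    (hi' _ _).const_mul _, ?_⟩
  rw [integral_finsetSum _ fun a _ => integrable_finsetSum _ fun b _ => (hi' _ _).const_mul _]
  simp only [integral_finsetSum _ fun b _ => (hi' _ _).const_mul _, integral_const_mul, hval]
  have hterm : ∀ s u : TensorIndex n d,
      a s * a u * ((∫ t, t ^ 4 ∂μ) ^ (u.1 ∩ s.1).card - 1) ≤
        K ^ 2 * (M ^ (u.1 ∩ s.1).card - 1) := by
    intro s u
    have hK : 0 ≤ K := (abs_nonneg _).trans (ha s)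
    -- For a nonempty intersection, `M ≥ 2` makes the right side at least `1`, which covers the
    -- lower bound without comparing the fourth moment with `1`.
    have h1 : |(∫ t, t ^ 4 ∂μ) ^ (u.1 ∩ s.1).card - 1| ≤ M ^ (u.1 ∩ s.1).card - 1 := by
      rcases Nat.eq_zero_or_pos (u.1 ∩ s.1).card with h0 | h0
      · simp [h0]
      · have h2 := pow_le_pow_left₀ h.fourth_nonneg h.fourth (u.1 ∩ s.1).card
        have h3 := pow_nonneg h.fourth_nonneg (u.1 ∩ s.1).card
        have h4 : M ^ 1 ≤ M ^ (u.1 ∩ s.1).card := pow_le_pow_right₀ (by linarith) h0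
        rw [abs_le]
        constructor <;> linarith
    calc _ ≤ |a s * a u * ((∫ t, t ^ 4 ∂μ) ^ (u.1 ∩ s.1).card - 1)| := le_abs_self _
      _ = |a s| * |a u| * |(∫ t, t ^ 4 ∂μ) ^ (u.1 ∩ s.1).card - 1| := by rw [abs_mul, abs_mul]
      _ ≤ K * K * (M ^ (u.1 ∩ s.1).card - 1) := by gcongr <;> apply ha
      _ = _ := by ring
  refine (Finset.sum_le_sum fun s _ => Finset.sum_le_sum fun u _ => hterm s u).trans ?_
  simp only [← Finset.mul_sum]
  have hrow : ∀ s : TensorIndex n d, ∑ u : TensorIndex n d, (M ^ (u.1 ∩ s.1).card - 1) ≤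
      n.choose d * varianceRate n d M := fun s =>
    sum_pow_card_inter_le_varianceRate (by linarith) (by rw [s.2]; omega)
  have h1 := Finset.sum_le_sum fun s (_ : s ∈ Finset.univ) => hrow s
  rw [Finset.sum_const, Finset.card_univ, card_tensorIndex, nsmul_eq_mul] at h1
  calc _ ≤ K ^ 2 * (n.choose d * (n.choose d * varianceRate n d M)) := by gcongr
    _ = _ := by ring

-- Split the centred form into its diagonal and off-diagonal parts. The factor `4` comes from `(a +
-- b)² ≤ 2 a² + 2 b²` and the equal bounds for the two parts.
open Matrix in
theorem IsEntryLaw.quadForm_variance_le (h : IsEntryLaw μ M) {K : ℝ}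
    {A : Matrix (TensorIndex n d) (TensorIndex n d) ℝ} (hA : ∀ s, ∑ u, A s u ^ 2 ≤ K ^ 2)
    (hdiag : ∀ s, |A s s| ≤ K) :
    ∫⁻ z, ENNReal.ofReal ((z ⬝ᵥ (A *ᵥ z) - A.trace) ^ 2) ∂(tensorLaw n d μ) ≤
      ENNReal.ofReal (4 * ((n.choose d) ^ 2 * K ^ 2 * varianceRate n d M)) := by
  classical
  have hsplit : ∀ z : TensorIndex n d → ℝ, z ⬝ᵥ (A *ᵥ z) - A.trace =
      ∑ s, A s s * (z s ^ 2 - 1) +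
      ∑ a : TensorIndex n d × TensorIndex n d,
        (if a.1 = a.2 then 0 else A a.1 a.2) * (z a.1 * z a.2) := by
    intro z
    rw [Fintype.sum_prod_type, ← Finset.sum_add_distrib, Matrix.trace, dotProduct,
      ← Finset.sum_sub_distrib]
    refine Finset.sum_congr rfl fun s _ => ?_
    have h1 : ∀ u, (if s = u then 0 else A s u) * (z s * z u) =
        z s * (A s u * z u) - if s = u then z s * (A s u * z u) else 0 := by
      intro u
      split_ifs <;> ring
    simp only [h1, Finset.sum_sub_distrib, Finset.sum_ite_eq, Finset.mem_univ, if_true, mulVec,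
      dotProduct, ← Finset.mul_sum, diag_apply]
    ring
  have h1 := h.diag_secondMoment_le (d := d) (a := fun s => A s s) hdiag
  have h2 := h.offDiag_secondMoment_le (d := d) (K := K)
    (B := Matrix.of fun s u => if s = u then 0 else A s u) (fun s => by
      refine le_trans (Finset.sum_le_sum fun u _ => ?_) (hA s)
      simp only [of_apply]
      split_ifs
      · simpa using sq_nonneg (A s u)
      · rfl) (by simp)
  rw [tensorLaw, lintegral_map (by simp only [dotProduct, mulVec]; fun_prop)
    measurable_tensorVector]
  have h3 : ∀ x : Fin n → ℝ, ENNReal.ofReal ((tensorVector n d x ⬝ᵥ (A *ᵥ tensorVector n d x) -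
      A.trace) ^ 2) ≤ ENNReal.ofReal (2 * (∑ s, A s s * (tensorVector n d x s ^ 2 - 1)) ^ 2 +
      2 * (∑ a : TensorIndex n d × TensorIndex n d,
        (Matrix.of fun s u => if s = u then 0 else A s u) a.1 a.2 *
          (tensorVector n d x a.1 * tensorVector n d x a.2)) ^ 2) := by
    intro x
    apply ENNReal.ofReal_le_ofReal
    rw [hsplit]
    simp only [of_apply]
    nlinarith [sq_nonneg (∑ s, A s s * (tensorVector n d x s ^ 2 - 1) -
      ∑ a : TensorIndex n d × TensorIndex n d,
        (if a.1 = a.2 then 0 else A a.1 a.2) *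
          (tensorVector n d x a.1 * tensorVector n d x a.2))]
  refine (lintegral_mono h3).trans ?_
  rw [← ofReal_integral_eq_lintegral_ofReal ((h1.1.const_mul 2).fun_add (h2.1.const_mul 2))
    (ae_of_all _ fun x => by positivity)]
  apply ENNReal.ofReal_le_ofReal
  rw [integral_add (h1.1.const_mul 2) (h2.1.const_mul 2), integral_const_mul, integral_const_mul]
  linarith [h1.2, h2.2]

end QuadraticForm

/-! ### Resampling and the bounded differences inequality. -/

section Concentration

variable {X : Type*} [MeasurableSpace X] (ν : Measure X) [IsProbabilityMeasure ν]

/-- Resampling one coordinate preserves a product measure. -/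
theorem measurePreserving_update {p : ℕ} (j : Fin p) :
    MeasurePreserving (fun q : (Fin p → X) × X => Function.update q.1 j q.2)
      ((Measure.pi fun _ : Fin p => ν).prod ν) (Measure.pi fun _ : Fin p => ν) := by
  have hm : Measurable fun q : (Fin p → X) × X => Function.update q.1 j q.2 := by
    refine measurable_pi_lambda _ fun i => ?_
    by_cases h : i = j
    · subst h; simpa using measurable_snd
    · simpa [h, Function.comp_def] using (measurable_pi_apply i).comp measurable_fst
  refine ⟨hm, (Measure.pi_eq fun s hs => ?_).symm⟩
  rw [Measure.map_apply hm (MeasurableSet.univ_pi hs)]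
  have h1 : (fun q : (Fin p → X) × X => Function.update q.1 j q.2) ⁻¹' Set.univ.pi s =
      (Set.univ.pi (Function.update s j Set.univ)) ×ˢ s j := by
    ext ⟨x, y⟩
    simp only [Set.mem_preimage, Set.mem_pi, Set.mem_univ, true_imp_iff, Set.mem_prod]
    constructor
    · intro h
      refine ⟨fun i => ?_, by simpa using h j⟩
      by_cases hi : i = j
      · subst hi; simp
      · simpa [hi] using h i
    · rintro ⟨h2, h3⟩ i
      by_cases hi : i = j
      · subst hi; simpa using h3
      · simpa [hi] using h2 i
  rw [h1, Measure.prod_prod, Measure.pi_pi, ← Finset.prod_erase_mul _ _ (Finset.mem_univ j),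
    ← Finset.prod_erase_mul (Finset.univ) (fun i => ν (s i)) (Finset.mem_univ j)]
  simp only [Function.update_self, measure_univ, mul_one]
  congr 1
  refine Finset.prod_congr rfl fun i hi => ?_
  rw [Function.update_of_ne (Finset.ne_of_mem_erase hi)]

/-- This form of Fubini suits leave-one-out quantities: they ignore coordinate `j`, so the inner
integral sees them as constants. -/
theorem lintegral_pi_eq_lintegral_update {p : ℕ} (j : Fin p) {f : (Fin p → X) → ENNReal}
    (hf : Measurable f) :
    ∫⁻ z, f z ∂(Measure.pi fun _ : Fin p => ν) =
      ∫⁻ z, ∫⁻ w, f (Function.update z j w) ∂ν ∂(Measure.pi fun _ : Fin p => ν) := by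
  have h := measurePreserving_update ν j
  rw [← h.lintegral_comp hf]
  exact lintegral_prod _ (hf.comp h.measurable).aemeasurable

theorem piFinSuccAbove_symm_zero {p : ℕ} (q : X × (Fin p → X)) :
    (MeasurableEquiv.piFinSuccAbove (fun _ : Fin (p + 1) => X) 0).symm q = Fin.cons q.1 q.2 := by
  rw [MeasurableEquiv.piFinSuccAbove_symm_apply]
  simp [Fin.insertNthEquiv, Fin.insertNth_zero']

theorem measurable_cons {p : ℕ} :
    Measurable fun q : X × (Fin p → X) => (Fin.cons q.1 q.2 : Fin (p + 1) → X) := by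
  rw [← funext piFinSuccAbove_symm_zero]
  exact MeasurableEquiv.measurable _

theorem integral_pi_succ {p : ℕ} {f : (Fin (p + 1) → X) → ℝ} (hf : Measurable f) {b : ℝ}
    (hb : ∀ z, |f z| ≤ b) :
    ∫ z, f z ∂(Measure.pi fun _ : Fin (p + 1) => ν) =
      ∫ y, ∫ x, f (Fin.cons x y) ∂ν ∂(Measure.pi fun _ : Fin p => ν) := by
  have h := (measurePreserving_piFinSuccAbove (fun _ : Fin (p + 1) => ν) 0).symm
  rw [← h.integral_comp', integral_prod_symm]
  · simp only [piFinSuccAbove_symm_zero]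
  · refine Integrable.of_bound (C := b) ?_ (ae_of_all _ fun q => hb _)
    exact (hf.comp (MeasurableEquiv.measurable _)).aestronglyMeasurable

/-- Functions with bounded differences of independent variables are sub-Gaussian. -/
theorem integral_exp_le_of_bounded_differences {p : ℕ} {f : (Fin p → X) → ℝ}
    (hf : Measurable f) {b : ℝ} (hb : ∀ z, |f z| ≤ b) {c : ℝ}
    (hc : ∀ z j w, |f z - f (Function.update z j w)| ≤ c) (l : ℝ) :
    ∫ z, Real.exp (l * (f z - ∫ y, f y ∂(Measure.pi fun _ : Fin p => ν)))
      ∂(Measure.pi fun _ : Fin p => ν) ≤ Real.exp (p * c ^ 2 * l ^ 2 / 2) := by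
  induction p with
  | zero =>
    have h : ∀ z, f z = f default := fun z => by rw [Subsingleton.elim z default]
    simp [h]
  | succ p ih =>
    set π := Measure.pi fun _ : Fin p => ν
    have hfc : Measurable fun q : X × (Fin p → X) => f (Fin.cons q.1 q.2) :=
      hf.comp measurable_cons
    have hfx : ∀ y : Fin p → X, Measurable fun x => f (Fin.cons x y) := fun y =>
      hfc.comp (measurable_id.prodMk measurable_const)
    have hfi : ∀ y : Fin p → X, Integrable (fun x => f (Fin.cons x y)) ν := fun y =>
      Integrable.of_bound (C := b) (hfx y).aestronglyMeasurable (ae_of_all _ fun x => hb _)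
    -- Averaging out the first coordinate preserves the bounded differences, so the induction
    -- hypothesis applies to `g`; the fluctuation of `f` around `g` is handled by Hoeffding's lemma.
    set g : (Fin p → X) → ℝ := fun y => ∫ x, f (Fin.cons x y) ∂ν with hg
    have hgm : Measurable g := by
      have : StronglyMeasurable fun y : Fin p → X => ∫ x, f (Fin.cons x y) ∂ν :=
        hfc.stronglyMeasurable.integral_prod_left'
      exact this.measurable
    have hgb : ∀ y, |g y| ≤ b := fun y => by
      have := norm_integral_le_of_norm_le_const (μ := ν) (f := fun x => f (Fin.cons x y))
        (C := b) (ae_of_all _ fun x => hb _)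
      simpa using this
    have hgc : ∀ y j w, |g y - g (Function.update y j w)| ≤ c := fun y j w => by
      rw [hg]
      dsimp only
      rw [← integral_sub (hfi _) (hfi _)]
      have := norm_integral_le_of_norm_le_const (μ := ν)
        (f := fun x => f (Fin.cons x y) - f (Fin.cons x (Function.update y j w)))
        (C := c) (ae_of_all _ fun x => by
          have := hc (Fin.cons x y) j.succ w
          rwa [← Fin.cons_update (α := fun _ => X)] at this)
      simpa using this
    have hE : ∫ z, f z ∂(Measure.pi fun _ : Fin (p + 1) => ν) = ∫ y, g y ∂π :=
      integral_pi_succ ν hf hb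
    have hEb : |∫ y, g y ∂π| ≤ b := by
      have := norm_integral_le_of_norm_le_const (μ := π) (f := g)
        (C := b) (ae_of_all _ fun x => hgb _)
      simpa using this
    have hexpb : ∀ a : ℝ, |a| ≤ b → Real.exp (l * (a - ∫ y, g y ∂π)) ≤
        Real.exp (|l| * (b + b)) := by
      intro a ha
      rw [Real.exp_le_exp]
      calc l * (a - ∫ y, g y ∂π) ≤ |l * (a - ∫ y, g y ∂π)| := le_abs_self _
        _ = |l| * |a - ∫ y, g y ∂π| := abs_mul _ _
        _ ≤ _ := by
          gcongr
          exact (abs_sub _ _).trans (add_le_add ha hEb)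
    rw [hE, integral_pi_succ ν (b := Real.exp (|l| * (b + b))) (by fun_prop)
      (fun z => by rw [abs_of_pos (Real.exp_pos _)]; exact hexpb _ (hb z))]
    have hinner : ∀ y : Fin p → X, ∫ x, Real.exp (l * (f (Fin.cons x y) - ∫ y, g y ∂π)) ∂ν ≤
        Real.exp (c ^ 2 * l ^ 2 / 2) * Real.exp (l * (g y - ∫ y, g y ∂π)) := by
      intro y
      obtain ⟨x₀⟩ := ν.nonempty_of_neZero
      -- The interval of length `2c` around a reference value gives the variance proxy `c²` per
      -- coordinate.
      have hH := hasSubgaussianMGF_of_mem_Icc (μ := ν) (X := fun x => f (Fin.cons x y))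
        (a := f (Fin.cons x₀ y) - c) (b := f (Fin.cons x₀ y) + c) (hfx y).aemeasurable
        (ae_of_all _ fun x => by
          have := hc (Fin.cons x₀ y) 0 x
          rw [Fin.update_cons_zero, abs_le] at this
          constructor <;> linarith [this.1, this.2])
      have h1 := hH.mgf_le l
      have h2 : (((‖f (Fin.cons x₀ y) + c - (f (Fin.cons x₀ y) - c)‖₊ / 2) ^ 2 : NNReal) : ℝ) =
          c ^ 2 := by
        push_cast
        rw [Real.norm_eq_abs, div_pow, sq_abs]
        ring
      rw [h2] at h1
      unfold mgf at h1
      calc _ = ∫ x, Real.exp (l * (f (Fin.cons x y) - g y)) *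
            Real.exp (l * (g y - ∫ y, g y ∂π)) ∂ν := by
            congr 1
            ext x
            rw [← Real.exp_add]
            congr 1
            ring
        _ = (∫ x, Real.exp (l * (f (Fin.cons x y) - g y)) ∂ν) *
            Real.exp (l * (g y - ∫ y, g y ∂π)) := integral_mul_const _ _
        _ ≤ _ := mul_le_mul_of_nonneg_right h1 (Real.exp_pos _).le
    have hgi : Integrable (fun y => Real.exp (l * (g y - ∫ y, g y ∂π))) π :=
      Integrable.of_bound (C := Real.exp (|l| * (b + b))) (by fun_prop)
        (ae_of_all _ fun y => by
          rw [Real.norm_eq_abs, abs_of_pos (Real.exp_pos _)]; exact hexpb _ (hgb y))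
    calc _ ≤ ∫ y, Real.exp (c ^ 2 * l ^ 2 / 2) * Real.exp (l * (g y - ∫ y, g y ∂π)) ∂π := by
          refine integral_mono_of_nonneg (ae_of_all _ fun y => ?_) (hgi.const_mul _)
            (ae_of_all _ hinner)
          exact integral_nonneg fun x => (Real.exp_pos _).le
      _ = Real.exp (c ^ 2 * l ^ 2 / 2) * ∫ y, Real.exp (l * (g y - ∫ y, g y ∂π)) ∂π :=
          integral_const_mul _ _
      _ ≤ Real.exp (c ^ 2 * l ^ 2 / 2) * Real.exp (p * c ^ 2 * l ^ 2 / 2) :=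
          mul_le_mul_of_nonneg_left (ih hgm hgb hgc) (Real.exp_pos _).le
      _ = _ := by
          rw [← Real.exp_add]
          congr 1
          push_cast
          ring

/-- The bounded differences inequality. -/
theorem measure_abs_sub_integral_ge_le {p : ℕ} {f : (Fin p → X) → ℝ}
    (hf : Measurable f) {b : ℝ} (hb : ∀ z, |f z| ≤ b) {c : NNReal}
    (hc : ∀ z j w, |f z - f (Function.update z j w)| ≤ c) {ε : ℝ} (hε : 0 ≤ ε) :
    (Measure.pi fun _ : Fin p => ν).real
      {z | ε ≤ |f z - ∫ y, f y ∂(Measure.pi fun _ : Fin p => ν)|} ≤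
      2 * Real.exp (-ε ^ 2 / (2 * (p * c ^ 2))) := by
  set π := Measure.pi fun _ : Fin p => ν
  have hEb : |∫ y, f y ∂π| ≤ b := by
    have := norm_integral_le_of_norm_le_const (μ := π) (f := f)
      (C := b) (ae_of_all _ fun x => hb _)
    simpa using this
  have hS : HasSubgaussianMGF (fun z => f z - ∫ y, f y ∂π) (p * c ^ 2) π := by
    refine ⟨fun l => ?_, fun l => ?_⟩
    · refine Integrable.of_bound (C := Real.exp (|l| * (b + b))) (by fun_prop)
        (ae_of_all _ fun z => ?_)
      rw [Real.norm_eq_abs, abs_of_pos (Real.exp_pos _), Real.exp_le_exp]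
      calc l * (f z - ∫ y, f y ∂π) ≤ |l * (f z - ∫ y, f y ∂π)| := le_abs_self _
        _ = |l| * |f z - ∫ y, f y ∂π| := abs_mul _ _
        _ ≤ _ := by
          gcongr
          exact (abs_sub _ _).trans (add_le_add (hb z) hEb)
    · have := integral_exp_le_of_bounded_differences ν hf hb hc l
      simpa [mgf] using this
  have h1 := hS.measure_ge_le hε
  have h2 := hS.neg.measure_ge_le hε
  have hsub : {z | ε ≤ |f z - ∫ y, f y ∂π|} ⊆
      {z | ε ≤ f z - ∫ y, f y ∂π} ∪ {z | ε ≤ (-fun z => f z - ∫ y, f y ∂π) z} := by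
    intro z hz
    exact le_abs.1 (Set.mem_ofPred_eq ▸ hz)
  refine (measureReal_mono hsub).trans ((measureReal_union_le _ _).trans ?_)
  push_cast at h1 h2
  linarith

end Concentration

/-! ### The self-consistent equation and its stability. -/

section SelfConsistent

/-- Nonnegativity of the variance of `|Y|`. The hypothesis is a Lebesgue integral, so that it yields
integrability instead of presupposing it. -/
theorem integral_abs_le_sqrt {X : Type*} [MeasurableSpace X] {π : Measure X}
    [IsProbabilityMeasure π] {Y : X → ℝ} (hY : AEStronglyMeasurable Y π) {B : ℝ} (hB : 0 ≤ B)
    (h : ∫⁻ x, ENNReal.ofReal (Y x ^ 2) ∂π ≤ ENNReal.ofReal B) :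
    Integrable Y π ∧ ∫ x, |Y x| ∂π ≤ √B := by
  have h2 : Integrable (fun x => Y x ^ 2) π := by
    refine ⟨hY.pow 2, ?_⟩
    rw [hasFiniteIntegral_iff_ofReal (ae_of_all _ fun x => sq_nonneg _)]
    exact h.trans_lt ENNReal.ofReal_lt_top
  have h2' : ∫ x, Y x ^ 2 ∂π ≤ B := by
    rw [integral_eq_lintegral_of_nonneg_ae (ae_of_all _ fun x => sq_nonneg _)
      h2.aestronglyMeasurable]
    exact ENNReal.toReal_le_of_le_ofReal hB h
  have h1 : Integrable Y π := by
    refine ((integrable_const (1 : ℝ)).add h2).mono' hY (ae_of_all _ fun x => ?_)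
    simp only [Pi.add_apply, Real.norm_eq_abs, ← sq_abs (Y x)]
    nlinarith [sq_nonneg (|Y x| - 1), abs_nonneg (Y x)]
  refine ⟨h1, Real.le_sqrt_of_sq_le ?_⟩
  set c := ∫ x, |Y x| ∂π with hc
  have h3 : 0 ≤ ∫ x, (|Y x| - c) ^ 2 ∂π := integral_nonneg fun x => sq_nonneg _
  have h4 : ∀ x, (|Y x| - c) ^ 2 = Y x ^ 2 - 2 * c * |Y x| + c ^ 2 := fun x => by
    rw [← sq_abs (Y x)]; ring
  simp only [h4] at h3
  rw [integral_add (h2.sub' (h1.abs.const_mul _)) (integrable_const _),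
    integral_sub h2 (h1.abs.const_mul _), integral_const_mul, ← hc] at h3
  simp at h3
  nlinarith

variable {n d p : ℕ} {μ : Measure ℝ} [IsProbabilityMeasure μ] {M : ℝ}

instance : IsProbabilityMeasure (tensorLaw n d μ) :=
  Measure.isProbabilityMeasure_map measurable_tensorVector.aemeasurable

theorem measurable_resolventTrace {ι : Type*} [Fintype ι] [DecidableEq ι] {t : ℝ} (ht : 0 < t) :
    Measurable fun z : Fin p → ι → ℝ => resolventTrace t z :=
  (continuous_resolventTrace ht).measurable

theorem abs_resolventTrace_le {ι : Type*} [Fintype ι] [DecidableEq ι] {t : ℝ} (ht : 0 < t)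
    (z : Fin p → ι → ℝ) : |resolventTrace t z| ≤ 1 / t := by
  rw [abs_of_nonneg (resolventTrace_nonneg ht z)]
  exact resolventTrace_le ht z

/-- The normalised trace of the leave-one-out resolvent. -/
def leaveOneOutTrace {ι : Type*} [Fintype ι] [DecidableEq ι] (t : ℝ) (j : Fin p)
    (z : Fin p → ι → ℝ) : ℝ :=
  (1 / (p : ℝ)) * ((shiftedCov t (Finset.univ.erase j) z)⁻¹).trace

theorem continuous_leaveOneOutTrace {ι : Type*} [Fintype ι] [DecidableEq ι] {t : ℝ} (ht : 0 < t)
    (j : Fin p) : Continuous fun z : Fin p → ι → ℝ => leaveOneOutTrace t j z :=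
  continuous_const.mul (continuous_inv_shiftedCov ht _).matrix_trace

/-- Resample column `j`: the leave-one-out resolvent is unchanged, so the inner integral is the
variance of a quadratic form with a fixed matrix. -/
theorem lintegral_leaveOneOut_sub_sq_le (h : IsEntryLaw μ M) {t : ℝ} (ht : 0 < t) (j : Fin p) :
    ∫⁻ z, ENNReal.ofReal ((leaveOneOut t j z - leaveOneOutTrace t j z) ^ 2)
      ∂(Measure.pi fun _ : Fin p => tensorLaw n d μ) ≤
      ENNReal.ofReal (4 * ((n.choose d / p) ^ 2 * (1 / t) ^ 2 * varianceRate n d M)) := by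
  rw [lintegral_pi_eq_lintegral_update _ j]
  swap
  · exact (((continuous_leaveOneOut ht j).sub (continuous_leaveOneOutTrace ht j)).pow
      2).measurable.ennreal_ofReal
  refine (lintegral_mono (g := fun _ => ENNReal.ofReal (4 * ((n.choose d / p) ^ 2 * (1 / t) ^ 2 *
    varianceRate n d M))) fun z => ?_).trans_eq (by simp)
  have hR := shiftedCov_boundedBelow ht (Finset.univ.erase j) z
  have h1 := h.quadForm_variance_le (K := 1 / t) (A := (shiftedCov t (Finset.univ.erase j) z)⁻¹)
    hR.sum_sq_row_le (fun s => by
      rw [abs_of_nonneg (hR.inv_diag_nonneg s)]; exact hR.inv_diag_le s)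
  simp only [leaveOneOut, leaveOneOutTrace, shiftedCov_erase_update, Function.update_self,
    ← mul_sub, mul_pow]
  have h2 : 0 ≤ (1 / (p : ℝ)) ^ 2 := by positivity
  simp only [ENNReal.ofReal_mul h2]
  rw [lintegral_const_mul' _ _ ENNReal.ofReal_ne_top]
  refine (mul_le_mul_right h1 _).trans_eq ?_
  rw [← ENNReal.ofReal_mul h2]
  congr 1
  ring

theorem abs_one_div_sub_le {a b : ℝ} (ha : 0 ≤ a) (hb : 0 ≤ b) :
    |1 / (1 + a) - 1 / (1 + b)| ≤ |a - b| := by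
  have h1 : 1 / (1 + a) - 1 / (1 + b) = (b - a) / ((1 + a) * (1 + b)) := by
    field_simp
    ring
  rw [h1, abs_div, abs_sub_comm b a]
  apply div_le_self (abs_nonneg _)
  rw [abs_of_pos (by positivity)]
  nlinarith [mul_nonneg ha hb]

/-- The approximate self-consistent equation for the expected normalised resolvent trace. -/
theorem abs_selfConsistent_le (h : IsEntryLaw μ M) {t : ℝ} (ht : 0 < t) (hp : 0 < p)
    (hN : 0 < n.choose d) {m : ℝ}
    (hm : m = ∫ z, resolventTrace t z ∂(Measure.pi fun _ : Fin p => tensorLaw n d μ)) :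
    |(n.choose d / p : ℝ) * (1 - t * m) - (1 - 1 / (1 + (n.choose d / p : ℝ) * m))| ≤
      √(4 * ((n.choose d / p) ^ 2 * (1 / t) ^ 2 * varianceRate n d M)) + 1 / t / p +
      (n.choose d / p : ℝ) * ∫ z, |resolventTrace t z - m|
        ∂(Measure.pi fun _ : Fin p => tensorLaw n d μ) := by
  have hp' : (0 : ℝ) < p := by exact_mod_cast hp
  have hN' : (0 : ℝ) < n.choose d := by exact_mod_cast hN
  have hM := h.two_le
  set π := Measure.pi fun _ : Fin p => tensorLaw n d μ with hπ
  set g : ℝ := n.choose d / p with hg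
  have hg0 : 0 ≤ g := by positivity
  have hm0 : 0 ≤ m := by rw [hm]; exact integral_nonneg fun z => resolventTrace_nonneg ht z
  have hfi : Integrable (fun z => resolventTrace t z) π :=
    Integrable.of_bound (C := 1 / t) (measurable_resolventTrace ht).aestronglyMeasurable
      (ae_of_all _ fun z => abs_resolventTrace_le ht z)
  have hqi : ∀ j : Fin p, Integrable (fun z => 1 / (1 + leaveOneOut t j z)) π := fun j =>
    Integrable.of_bound (C := 1)
      ((measurable_const.add (continuous_leaveOneOut ht j).measurable).const_div 1
        ).aestronglyMeasurable
      (ae_of_all _ fun z => by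
        have := leaveOneOut_nonneg ht j z
        rw [Real.norm_eq_abs, abs_of_nonneg (by positivity)]
        exact div_le_one_of_le₀ (by linarith) (by positivity))
  have hid : g * (1 - t * m) =
      (1 / (p : ℝ)) * ∑ j : Fin p, (1 - ∫ z, 1 / (1 + leaveOneOut t j z) ∂π) := by
    have h1 : ∀ z : Fin p → TensorIndex n d → ℝ, g * (1 - t * resolventTrace t z) =
        (1 / (p : ℝ)) * ∑ j : Fin p, (1 - 1 / (1 + leaveOneOut t j z)) := by
      intro z
      rw [← card_sub_trace_eq ht z, resolventTrace, card_tensorIndex, hg]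
      field_simp
    have h2 : ∫ z, g * (1 - t * resolventTrace t z) ∂π = g * (1 - t * m) := by
      rw [integral_const_mul, integral_sub (integrable_const _) (hfi.const_mul _),
        integral_const_mul, ← hm]
      simp
    rw [← h2]
    simp only [h1]
    rw [integral_const_mul, integral_finsetSum _ fun j _ => (integrable_const _).sub' (hqi j)]
    congr 1
    refine Finset.sum_congr rfl fun j _ => ?_
    rw [integral_sub (integrable_const _) (hqi j)]
    simp
  have hj : ∀ j : Fin p, |∫ z, 1 / (1 + leaveOneOut t j z) ∂π - 1 / (1 + g * m)| ≤
      √(4 * (g ^ 2 * (1 / t) ^ 2 * varianceRate n d M)) + 1 / t / p +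
      g * ∫ z, |resolventTrace t z - m| ∂π := by
    intro j
    have hB : 0 ≤ 4 * (g ^ 2 * (1 / t) ^ 2 * varianceRate n d M) := by
      have := varianceRate_nonneg (n := n) (d := d) (M := M) (by linarith)
      positivity
    obtain ⟨hY, hYle⟩ := integral_abs_le_sqrt (π := π)
      (Y := fun z => leaveOneOut t j z - leaveOneOutTrace t j z)
      ((continuous_leaveOneOut ht j).sub (continuous_leaveOneOutTrace ht j)
        ).measurable.aestronglyMeasurable hB
      (lintegral_leaveOneOut_sub_sq_le h ht j)
    have hdev : Integrable (fun z => |resolventTrace t z - m|) π :=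
      (hfi.sub' (integrable_const m)).abs
    -- Three replacements, from `qⱼ` to `p⁻¹ tr R⁽ʲ⁾`, then to `p⁻¹ tr R`, then to `g m`: their
    -- costs are a quadratic-form fluctuation, a rank-one perturbation, and the deviation of the
    -- trace from its mean.
    have hpt : ∀ z : Fin p → TensorIndex n d → ℝ,
        |1 / (1 + leaveOneOut t j z) - 1 / (1 + g * m)| ≤
        |leaveOneOut t j z - leaveOneOutTrace t j z| + 1 / t / p +
          g * |resolventTrace t z - m| := by
      intro z
      refine (abs_one_div_sub_le (leaveOneOut_nonneg ht j z) (mul_nonneg hg0 hm0)).trans ?_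
      have h1 := trace_erase_sub_bounds ht j z
      have h2 : |leaveOneOutTrace t j z - g * resolventTrace t z| ≤ 1 / t / p := by
        have h3 : leaveOneOutTrace t j z - g * resolventTrace t z =
            (((shiftedCov t (Finset.univ.erase j) z)⁻¹).trace -
              ((shiftedCov t Finset.univ z)⁻¹).trace) / p := by
          rw [leaveOneOutTrace, resolventTrace, card_tensorIndex, hg]
          field_simp
        rw [h3, abs_div, Nat.abs_cast, abs_of_nonneg h1.1]
        gcongr
        exact h1.2
      have h4 : g * |resolventTrace t z - m| = |g * resolventTrace t z - g * m| := by
        rw [← mul_sub, abs_mul, abs_of_nonneg hg0]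
      rw [h4]
      have h5 := abs_sub_le (leaveOneOut t j z) (leaveOneOutTrace t j z) (g * m)
      have h6 := abs_sub_le (leaveOneOutTrace t j z) (g * resolventTrace t z) (g * m)
      linarith
    calc |∫ z, 1 / (1 + leaveOneOut t j z) ∂π - 1 / (1 + g * m)|
        = |∫ z, (1 / (1 + leaveOneOut t j z) - 1 / (1 + g * m)) ∂π| := by
          rw [integral_sub (hqi j) (integrable_const _)]
          simp
      _ ≤ ∫ z, |1 / (1 + leaveOneOut t j z) - 1 / (1 + g * m)| ∂π := abs_integral_le_integral_abs
      _ ≤ ∫ z, (|leaveOneOut t j z - leaveOneOutTrace t j z| + 1 / t / p +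
          g * |resolventTrace t z - m|) ∂π :=
          integral_mono ((hqi j).sub' (integrable_const _)).abs
            ((hY.abs.fun_add (integrable_const _)).fun_add (hdev.const_mul g)) hpt
      _ = ∫ z, |leaveOneOut t j z - leaveOneOutTrace t j z| ∂π + 1 / t / p +
          g * ∫ z, |resolventTrace t z - m| ∂π := by
          rw [integral_add (hY.abs.fun_add (integrable_const _)) (hdev.const_mul g),
            integral_add hY.abs (integrable_const _), integral_const_mul]
          simp
      _ ≤ _ := by gcongr
  have hsum : g * (1 - t * m) - (1 - 1 / (1 + g * m)) =
      (1 / (p : ℝ)) * ∑ j : Fin p, (1 / (1 + g * m) - ∫ z, 1 / (1 + leaveOneOut t j z) ∂π) := by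
    rw [hid, Finset.sum_sub_distrib, Finset.sum_sub_distrib]
    simp only [Finset.sum_const, Finset.card_univ, Fintype.card_fin, nsmul_eq_mul]
    field_simp
    ring
  rw [hsum, abs_mul, abs_of_nonneg (by positivity : (0 : ℝ) ≤ 1 / p)]
  have h7 := (Finset.abs_sum_le_sum_abs (fun j : Fin p => 1 / (1 + g * m) -
    ∫ z, 1 / (1 + leaveOneOut t j z) ∂π) Finset.univ).trans
    (Finset.sum_le_sum fun j _ => (abs_sub_comm _ _).trans_le (hj j))
  rw [Finset.sum_const, Finset.card_univ, Fintype.card_fin, nsmul_eq_mul] at h7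
  rw [one_div_mul_eq_div, div_le_iff₀' hp']
  exact h7

/-- A solution of the limiting self-consistent equation attracts approximate solutions. -/
theorem tendsto_of_selfConsistent {γ t b : ℝ} (hγ : 0 < γ) (ht : 0 < t) {m₀ : ℝ} (hm₀ : 0 < m₀)
    (heq : γ * t * m₀ ^ 2 + (t + 1 - γ) * m₀ - 1 = 0) {g m : ℕ → ℝ}
    (hg : Tendsto g atTop (𝓝 γ)) (hm0 : ∀ n, 0 ≤ m n) (hmb : ∀ n, m n ≤ b)
    (h : Tendsto (fun n => g n * (1 - t * m n) - (1 - 1 / (1 + g n * m n))) atTop (𝓝 0)) :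
    Tendsto m atTop (𝓝 m₀) := by
  have hbd : ∀ {u v : ℕ → ℝ} {B : ℝ}, Tendsto u atTop (𝓝 0) → (∀ n, |v n| ≤ B) →
      Tendsto (fun n => u n * v n) atTop (𝓝 0) := by
    intro u v B hu hv
    refine squeeze_zero_norm (a := fun n => |u n| * B) (fun n => ?_) ?_
    · rw [norm_mul]
      exact mul_le_mul_of_nonneg_left (hv n) (abs_nonneg _)
    · simpa using hu.abs.mul_const B
  have hmabs : ∀ n, |m n| ≤ b := fun n => by rw [abs_of_nonneg (hm0 n)]; exact hmb n
  have hmabs2 : ∀ n, |m n ^ 2| ≤ b ^ 2 := fun n => by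
    rw [abs_pow]
    exact pow_le_pow_left₀ (abs_nonneg _) (hmabs n) 2
  have hgpos : ∀ᶠ n in atTop, γ / 2 < g n := hg.eventually (lt_mem_nhds (by linarith))
  -- clear denominators
  have h1 : Tendsto (fun n => g n * (1 + (g n - t - 1) * m n - g n * t * m n ^ 2)) atTop (𝓝 0) := by
    have h2 : Tendsto (fun n => (g n * (1 - t * m n) - (1 - 1 / (1 + g n * m n))) +
        ((g n * (1 - t * m n) - (1 - 1 / (1 + g n * m n))) * g n) * m n) atTop (𝓝 0) := by
      have := h.mul hg
      rw [zero_mul] at this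
      simpa using h.add (hbd this hmabs)
    refine h2.congr' ?_
    filter_upwards [hgpos] with n hn
    have h3 : 1 + g n * m n ≠ 0 := by
      have := mul_nonneg (by linarith : 0 ≤ g n) (hm0 n)
      positivity
    field_simp
    ring
  have h4 : Tendsto (fun n => 1 + (g n - t - 1) * m n - g n * t * m n ^ 2) atTop (𝓝 0) := by
    have := h1.div hg hγ.ne'
    rw [zero_div] at this
    refine this.congr' ?_
    filter_upwards [hgpos] with n hn
    have : g n ≠ 0 := by linarith
    simp only [Pi.div_apply]
    field_simp
  have h5 : Tendsto (fun n => γ * t * m n ^ 2 + (t + 1 - γ) * m n - 1) atTop (𝓝 0) := by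
    have hgz : Tendsto (fun n => g n - γ) atTop (𝓝 0) := by
      simpa using hg.sub_const γ
    have hgt : Tendsto (fun n => (g n - γ) * t) atTop (𝓝 0) := by
      simpa using hgz.mul_const t
    have := (h4.neg.add (hbd hgz hmabs)).sub (hbd hgt hmabs2)
    simp only [neg_zero, add_zero, sub_zero] at this
    refine this.congr fun n => ?_
    ring
  rw [tendsto_iff_norm_sub_tendsto_zero]
  refine squeeze_zero (fun n => norm_nonneg _)
    (g := fun n => |γ * t * m n ^ 2 + (t + 1 - γ) * m n - 1| * m₀) (fun n => ?_) ?_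
  · have h6 : (γ * t * m n ^ 2 + (t + 1 - γ) * m n - 1) * m₀ =
        (m n - m₀) * (γ * t * m n * m₀ + 1) := by
      linear_combination (m n) * heq
    have h7 : 0 ≤ γ * t * m n * m₀ := by have := hm0 n; positivity
    calc ‖m n - m₀‖ = |m n - m₀| * 1 := by rw [mul_one, Real.norm_eq_abs]
      _ ≤ |m n - m₀| * (γ * t * m n * m₀ + 1) := by gcongr; linarith
      _ = |(m n - m₀) * (γ * t * m n * m₀ + 1)| := by
          rw [abs_mul, abs_of_pos (by linarith : 0 < γ * t * m n * m₀ + 1)]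
      _ = _ := by rw [← h6, abs_mul, abs_of_pos hm₀]
  · simpa using h5.abs.mul_const m₀

end SelfConsistent

/-! ### The Stieltjes transform of the Marchenko–Pastur law. -/

section MarchenkoPastur

theorem hasDerivAt_sqrt_sq_sub_sq {r u : ℝ} (hu : u ∈ Set.Ioo (-r) r) :
    HasDerivAt (fun u => √(r ^ 2 - u ^ 2)) (-u / √(r ^ 2 - u ^ 2)) u := by
  have h1 : 0 < r ^ 2 - u ^ 2 := by nlinarith [hu.1, hu.2]
  have h2 : HasDerivAt (fun u => r ^ 2 - u ^ 2) (-(2 * u)) u := by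
    simpa using (hasDerivAt_pow 2 u).const_sub (r ^ 2)
  convert h2.sqrt h1.ne' using 1
  rw [neg_div, neg_div, mul_div_mul_left _ _ two_ne_zero]

theorem hasDerivAt_arcsin_div {r u : ℝ} (hr : 0 < r) (hu : u ∈ Set.Ioo (-r) r) :
    HasDerivAt (fun u => Real.arcsin (u / r)) (1 / √(r ^ 2 - u ^ 2)) u := by
  have h1 : -1 < u / r := by rw [lt_div_iff₀ hr]; linarith [hu.1]
  have h2 : u / r < 1 := by rw [div_lt_iff₀ hr]; linarith [hu.2]
  have h3 := (Real.hasDerivAt_arcsin h1.ne' h2.ne).comp u ((hasDerivAt_id' u).div_const r)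
  refine h3.congr_deriv ?_
  have h4 : 1 - (u / r) ^ 2 = (r ^ 2 - u ^ 2) / r ^ 2 := by field_simp
  rw [h4, Real.sqrt_div' _ (sq_nonneg r), Real.sqrt_sq hr.le]
  field_simp

/-- An antiderivative of `√(r² - u²) / (c + u)`. -/
def semicircleAntideriv (r c u : ℝ) : ℝ :=
  √(r ^ 2 - u ^ 2) + c * Real.arcsin (u / r) -
    √(c ^ 2 - r ^ 2) * Real.arcsin ((r ^ 2 + c * u) / (r * (c + u)))

theorem hasDerivAt_semicircleAntideriv {r c u : ℝ} (hr : 0 < r) (hc : r ≤ c)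
    (hu : u ∈ Set.Ioo (-r) r) :
    HasDerivAt (semicircleAntideriv r c) (√(r ^ 2 - u ^ 2) / (c + u)) u := by
  have hcu : 0 < c + u := by linarith [hu.1]
  have h1 : 0 < r ^ 2 - u ^ 2 := by nlinarith [hu.1, hu.2]
  have hs := Real.sqrt_pos.2 h1
  have hsq := Real.sq_sqrt h1.le
  have hA := (hasDerivAt_sqrt_sq_sub_sq hu).add ((hasDerivAt_arcsin_div hr hu).const_mul c)
  -- For `c = r` the second arcsine has constant argument `1`, where `arcsin` is not differentiable,
  -- but its coefficient is zero. This case is needed for `γ = 1` and `t = 0`.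
  rcases hc.eq_or_lt with rfl | hc'
  · have h0 : semicircleAntideriv r r = fun u => √(r ^ 2 - u ^ 2) + r * Real.arcsin (u / r) := by
      ext v
      simp [semicircleAntideriv]
    rw [h0]
    refine hA.congr_deriv ?_
    rw [mul_one_div, ← add_div, div_eq_div_iff hs.ne' hcu.ne']
    linear_combination -hsq
  · have h2 : 0 < c ^ 2 - r ^ 2 := by nlinarith
    have ht := Real.sqrt_pos.2 h2
    have htq := Real.sq_sqrt h2.le
    set w := (r ^ 2 + c * u) / (r * (c + u)) with hw
    have hden : r * (c + u) ≠ 0 := by positivity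
    have hw2 : 1 - w ^ 2 = (c ^ 2 - r ^ 2) * (r ^ 2 - u ^ 2) / (r * (c + u)) ^ 2 := by
      rw [hw]
      field_simp
      ring
    have hwpos : 0 < 1 - w ^ 2 := by rw [hw2]; positivity
    have hwd : HasDerivAt (fun u => (r ^ 2 + c * u) / (r * (c + u)))
        ((c ^ 2 - r ^ 2) / (r * (c + u) ^ 2)) u := by
      have e1 : HasDerivAt (fun u => r ^ 2 + c * u) c u := by
        simpa using ((hasDerivAt_id u).const_mul c).const_add (r ^ 2)
      have e2 : HasDerivAt (fun u => r * (c + u)) r u := by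
        simpa using ((hasDerivAt_id u).const_add c).const_mul r
      refine (e1.div e2 hden).congr_deriv ?_
      have := hr.ne'
      have := hcu.ne'
      rw [div_eq_div_iff (by positivity) (by positivity)]
      ring
    have hB := (Real.hasDerivAt_arcsin (x := w) (by nlinarith) (by nlinarith)).comp u hwd
    have hC := hA.sub (hB.const_mul (√(c ^ 2 - r ^ 2)))
    refine hC.congr_deriv ?_
    rw [hw2, Real.sqrt_div' _ (sq_nonneg _), Real.sqrt_sq (by positivity),
      Real.sqrt_mul h2.le]
    set S := √(r ^ 2 - u ^ 2)
    set T := √(c ^ 2 - r ^ 2)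
    have e1 : T * (1 / (T * S / (r * (c + u))) * ((c ^ 2 - r ^ 2) / (r * (c + u) ^ 2))) =
        (c ^ 2 - r ^ 2) / (S * (c + u)) := by
      field_simp
    rw [e1, mul_one_div, ← add_div, div_sub_div _ _ hs.ne' (by positivity),
      div_eq_div_iff (by positivity) hcu.ne']
    linear_combination -(c + u) * S * hsq

theorem continuousOn_semicircleAntideriv {r c : ℝ} (hr : 0 < r) (hc : r ≤ c) :
    ContinuousOn (semicircleAntideriv r c) (Set.Icc (-r) r) := by
  unfold semicircleAntideriv
  rcases hc.eq_or_lt with rfl | hc'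
  · simp only [sub_self, Real.sqrt_zero, zero_mul, sub_zero]
    fun_prop
  · refine ContinuousOn.sub (by fun_prop) (continuousOn_const.mul ?_)
    refine Real.continuous_arcsin.comp_continuousOn ?_
    refine ContinuousOn.div (by fun_prop) (by fun_prop) fun u hu => ?_
    have : 0 < c + u := by linarith [hu.1]
    positivity

/-- The integrand is unbounded at `-r` when `c = r`; its integrability comes from its sign and an
antiderivative continuous up to the endpoints. -/
theorem semicircle_integrableOn {r c : ℝ} (hr : 0 < r) (hc : r ≤ c) :
    IntegrableOn (fun u => √(r ^ 2 - u ^ 2) / (c + u)) (Set.Ioc (-r) r) :=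
  intervalIntegral.integrableOn_deriv_of_nonneg (continuousOn_semicircleAntideriv hr hc)
    (fun u hu => hasDerivAt_semicircleAntideriv hr hc hu)
    (fun u hu => div_nonneg (Real.sqrt_nonneg _) (by linarith [hu.1]))

theorem integral_semicircle {r c : ℝ} (hr : 0 < r) (hc : r ≤ c) :
    ∫ u in (-r)..r, √(r ^ 2 - u ^ 2) / (c + u) = Real.pi * (c - √(c ^ 2 - r ^ 2)) := by
  rw [intervalIntegral.integral_eq_sub_of_hasDerivAt_of_le (by linarith)
    (continuousOn_semicircleAntideriv hr hc)
    (fun u hu => hasDerivAt_semicircleAntideriv hr hc hu)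
    ((intervalIntegrable_iff_integrableOn_Ioc_of_le (by linarith)).2
      (semicircle_integrableOn hr hc))]
  unfold semicircleAntideriv
  rcases hc.eq_or_lt with rfl | hc'
  · simp [neg_div, div_self hr.ne']
    ring
  · have h1 : (r ^ 2 + c * r) / (r * (c + r)) = 1 := by
      have : 0 < c + r := by linarith
      rw [div_eq_one_iff_eq (by positivity)]; ring
    have h2 : (r ^ 2 + c * (-r)) / (r * (c + -r)) = -1 := by
      have : c - r ≠ 0 := by linarith
      rw [← sub_eq_add_neg, div_eq_iff (mul_ne_zero hr.ne' this)]
      ring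
    rw [h1, h2]
    simp [neg_div, div_self hr.ne']
    ring

variable {γ : ℝ}

theorem mp_sq_sub (hγ : 0 < γ) (y : ℝ) :
    ((1 + √γ) ^ 2 - y) * (y - (1 - √γ) ^ 2) = (2 * √γ) ^ 2 - (y - (1 + γ)) ^ 2 := by
  have := Real.sq_sqrt hγ.le
  linear_combination (2 * y - √γ ^ 2 - γ - 2) * this

theorem mp_right (hγ : 0 < γ) : (1 + √γ) ^ 2 = 2 * √γ + (1 + γ) := by
  have := Real.sq_sqrt hγ.le
  linear_combination this

theorem mp_left (hγ : 0 < γ) : (1 - √γ) ^ 2 = -(2 * √γ) + (1 + γ) := by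
  have := Real.sq_sqrt hγ.le
  linear_combination this

theorem two_sqrt_le (hγ : 0 < γ) : 2 * √γ ≤ 1 + γ := by
  have := mp_left hγ
  nlinarith [sq_nonneg (1 - √γ)]

/-- The Marchenko–Pastur kernel `√((b - y)(y - a)) / (y + t)` on its support `[a, b]`. -/
def mpKernel (γ t : ℝ) : ℝ → ℝ :=
  (Set.Icc ((1 - √γ) ^ 2) ((1 + √γ) ^ 2)).indicator
    fun y => √((2 * √γ) ^ 2 - (y - (1 + γ)) ^ 2) / (1 + γ + t + (y - (1 + γ)))

theorem integrable_mpKernel (hγ : 0 < γ) {t : ℝ} (ht : 0 ≤ t) : Integrable (mpKernel γ t) := by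
  have hr : 0 < 2 * √γ := by positivity
  have h := (intervalIntegrable_iff_integrableOn_Ioc_of_le (by linarith)).2
    (semicircle_integrableOn hr (c := 1 + γ + t) (by linarith [two_sqrt_le hγ]))
  have h2 := h.comp_sub_right (1 + γ)
  rw [← mp_right hγ, ← mp_left hγ, intervalIntegrable_iff_integrableOn_Icc_of_le (by
    rw [mp_right hγ, mp_left hγ]; linarith)] at h2
  exact h2.integrable_indicator measurableSet_Icc

/-- Centring at `1 + γ` gives the semicircle integral with `r = 2√γ` and `c = 1 + γ + t`; the
condition `r ≤ c` is the inequality of means. -/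
theorem integral_mpKernel (hγ : 0 < γ) {t : ℝ} (ht : 0 ≤ t) :
    ∫ y, mpKernel γ t y = Real.pi * (1 + γ + t - √((1 + γ + t) ^ 2 - 4 * γ)) := by
  have hr : 0 < 2 * √γ := by positivity
  have hsq : (2 * √γ) ^ 2 = 4 * γ := by
    rw [mul_pow, Real.sq_sqrt hγ.le]; norm_num
  rw [mpKernel, integral_indicator measurableSet_Icc, integral_Icc_eq_integral_Ioc,
    ← intervalIntegral.integral_of_le (by rw [mp_right hγ, mp_left hγ]; linarith),
    mp_right hγ, mp_left hγ,
    intervalIntegral.integral_comp_sub_right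
      (fun u => √((2 * √γ) ^ 2 - u ^ 2) / (1 + γ + t + u)) (1 + γ), add_sub_cancel_right,
    add_sub_cancel_right, integral_semicircle hr (by linarith [two_sqrt_le hγ]), hsq]

theorem mpDensity_eq (hγ : 0 < γ) (y : ℝ) :
    mpDensity γ y = (1 / (2 * Real.pi * γ)) * mpKernel γ 0 y := by
  unfold mpDensity mpKernel
  by_cases hy : y ∈ Set.Icc ((1 - √γ) ^ 2) ((1 + √γ) ^ 2)
  · rw [Set.indicator_of_mem hy, Set.indicator_of_mem hy, mp_sq_sub hγ, one_div_mul_eq_div,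
      div_div, add_zero, add_sub_cancel, mul_comm y]
  · rw [Set.indicator_of_notMem hy, Set.indicator_of_notMem hy, mul_zero]

theorem mpDensity_nonneg (hγ : 0 < γ) (y : ℝ) : 0 ≤ mpDensity γ y := by
  refine Set.indicator_nonneg (fun y hy => ?_) y
  have : 0 ≤ y := (sq_nonneg _).trans hy.1
  positivity

theorem mpDensity_eq_zero_of_neg {y : ℝ} (hy : y < 0) : mpDensity γ y = 0 :=
  Set.indicator_of_notMem (fun h => not_lt.2 ((sq_nonneg _).trans h.1) hy) _

/-- Partial fractions for `1 / (y (y + t))`. -/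
theorem mpDensity_div (hγ : 0 < γ) {t : ℝ} (ht : 0 < t) (y : ℝ) :
    mpDensity γ y * (1 / (y + t)) =
      (1 / (2 * Real.pi * γ * t)) * (mpKernel γ 0 y - mpKernel γ t y) := by
  rw [mpDensity_eq hγ]
  unfold mpKernel
  by_cases hy : y ∈ Set.Icc ((1 - √γ) ^ 2) ((1 + √γ) ^ 2)
  · rw [Set.indicator_of_mem hy, Set.indicator_of_mem hy]
    have hy0 : 0 ≤ y := (sq_nonneg _).trans hy.1
    rw [add_zero, add_sub_cancel, show 1 + γ + t + (y - (1 + γ)) = y + t by ring]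
    rcases hy0.eq_or_lt with h | h
    -- The point `y = 0` lies in the support only as its left endpoint, where the square root
    -- vanishes.
    · have h1 : (2 * √γ) ^ 2 - (y - (1 + γ)) ^ 2 = 0 := by
        rw [← mp_sq_sub hγ]
        have : (1 - √γ) ^ 2 = 0 := le_antisymm (hy.1.trans_eq h.symm) (sq_nonneg _)
        rw [this, ← h]
        ring
      rw [h1]
      simp
    · have := Real.pi_pos
      field_simp
      ring
  · rw [Set.indicator_of_notMem hy, Set.indicator_of_notMem hy]
    simp

theorem integrable_mpDensity (hγ : 0 < γ) : Integrable (mpDensity γ) := by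
  rw [funext (mpDensity_eq hγ)]
  exact (integrable_mpKernel hγ le_rfl).const_mul _

theorem sqrt_mp_discriminant_zero : √((1 + γ + 0) ^ 2 - 4 * γ) = |γ - 1| := by
  rw [← Real.sqrt_sq_eq_abs]
  congr 1
  ring

theorem integral_mpDensity (hγ : 0 < γ) :
    ∫ y, mpDensity γ y = (1 + γ - |γ - 1|) / (2 * γ) := by
  simp only [mpDensity_eq hγ]
  rw [integral_const_mul, integral_mpKernel hγ le_rfl, sqrt_mp_discriminant_zero]
  have := Real.pi_pos
  field_simp
  ring

theorem integral_mpDensity_div (hγ : 0 < γ) {t : ℝ} (ht : 0 < t) :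
    ∫ y, mpDensity γ y * (1 / (y + t)) =
      (√((1 + γ + t) ^ 2 - 4 * γ) - |γ - 1| - t) / (2 * γ * t) := by
  simp only [mpDensity_div hγ ht]
  rw [integral_const_mul, integral_sub (integrable_mpKernel hγ le_rfl)
    (integrable_mpKernel hγ ht.le), integral_mpKernel hγ le_rfl, integral_mpKernel hγ ht.le,
    sqrt_mp_discriminant_zero]
  have := Real.pi_pos
  field_simp
  ring

/-- The mass of the Marchenko–Pastur law at the origin. -/
def mpAtom (γ : ℝ) : ℝ := if 1 < γ then 1 - 1 / γ else 0

theorem mpAtom_eq (hγ : 0 < γ) : mpAtom γ = (γ - 1 + |γ - 1|) / (2 * γ) := by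
  unfold mpAtom
  split_ifs with h
  · rw [abs_of_pos (by linarith)]
    field_simp
    ring
  · rw [abs_of_nonpos (by linarith)]
    ring

theorem mpAtom_nonneg (hγ : 0 < γ) : 0 ≤ mpAtom γ := by
  rw [mpAtom_eq hγ]
  have := neg_abs_le (γ - 1)
  exact div_nonneg (by linarith) (by positivity)

/-- The Marchenko–Pastur law. -/
def mpMeasure (γ : ℝ) : Measure ℝ :=
  ENNReal.ofReal (mpAtom γ) • Measure.dirac 0 +
    volume.withDensity fun y => ENNReal.ofReal (mpDensity γ y)

theorem isProbabilityMeasure_mpMeasure (hγ : 0 < γ) : IsProbabilityMeasure (mpMeasure γ) := by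
  refine ⟨?_⟩
  rw [mpMeasure, Measure.add_apply, Measure.smul_apply, withDensity_apply _ MeasurableSet.univ,
    Measure.restrict_univ, ← ofReal_integral_eq_lintegral_ofReal (integrable_mpDensity hγ)
      (ae_of_all _ (mpDensity_nonneg hγ)), integral_mpDensity hγ, measure_univ, smul_eq_mul,
    mul_one, ← ENNReal.ofReal_add (mpAtom_nonneg hγ), mpAtom_eq hγ, ← add_div]
  · rw [ENNReal.ofReal_eq_one]
    field_simp
    ring
  · rw [← integral_mpDensity hγ]
    exact integral_nonneg (mpDensity_nonneg hγ)

theorem mpMeasure_real_Iic (hγ : 0 < γ) (x : ℝ) :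
    (mpMeasure γ).real (Set.Iic x) = mpCDF γ x := by
  have h0 : 0 ≤ ∫ y in Set.Iic x, mpDensity γ y := integral_nonneg (mpDensity_nonneg hγ)
  have h1 : (if 0 ≤ x ∧ 1 < γ then 1 - 1 / γ else 0) = if 0 ≤ x then mpAtom γ else 0 := by
    unfold mpAtom
    split_ifs <;> tauto
  rw [measureReal_def, mpMeasure, Measure.add_apply, Measure.smul_apply,
    withDensity_apply _ measurableSet_Iic, ← ofReal_integral_eq_lintegral_ofReal
      (integrable_mpDensity hγ).integrableOn (ae_of_all _ (mpDensity_nonneg hγ)), mpCDF, h1,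
    Measure.dirac_apply' _ measurableSet_Iic]
  by_cases hx : 0 ≤ x
  · simp only [hx, if_true, Set.indicator_of_mem (Set.mem_Iic.2 hx), Pi.one_apply, smul_eq_mul,
      mul_one]
    rw [← ENNReal.ofReal_add (mpAtom_nonneg hγ) h0, ENNReal.toReal_ofReal]
    exact add_nonneg (mpAtom_nonneg hγ) h0
  · simp only [hx, if_false, Set.indicator_of_notMem (fun h => hx (Set.mem_Iic.1 h)), smul_zero,
      zero_add]
    rw [ENNReal.toReal_ofReal h0]

theorem mpMeasure_Iio_zero (γ : ℝ) : mpMeasure γ (Set.Iio 0) = 0 := by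
  rw [mpMeasure, Measure.add_apply, Measure.smul_apply, withDensity_apply _ measurableSet_Iio,
    Measure.dirac_apply' _ measurableSet_Iio, setLIntegral_congr_fun (g := fun _ => 0)
      measurableSet_Iio fun y hy => by rw [mpDensity_eq_zero_of_neg hy, ENNReal.ofReal_zero]]
  simp

theorem integral_mpMeasure (hγ : 0 < γ) {t : ℝ} (ht : 0 < t) :
    ∫ y, 1 / (y + t) ∂(mpMeasure γ) =
      (√((t + 1 - γ) ^ 2 + 4 * γ * t) - (t + 1 - γ)) / (2 * γ * t) := by
  have hm : AEMeasurable (mpDensity γ) := (integrable_mpDensity hγ).aemeasurable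
  have hm' : AEMeasurable (fun y => ENNReal.ofReal (mpDensity γ y)) := hm.ennreal_ofReal
  have htop : ∀ᵐ y : ℝ, ENNReal.ofReal (mpDensity γ y) < ⊤ :=
    ae_of_all _ fun _ => ENNReal.ofReal_lt_top
  have hcont : Integrable (fun y => 1 / (y + t))
      (volume.withDensity fun y => ENNReal.ofReal (mpDensity γ y)) := by
    rw [integrable_withDensity_iff_integrable_smul₀' hm' htop]
    simp only [ENNReal.toReal_ofReal (mpDensity_nonneg hγ _), smul_eq_mul, mpDensity_div hγ ht]
    exact ((integrable_mpKernel hγ le_rfl).sub (integrable_mpKernel hγ ht.le)).const_mul _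
  have hdirac : Integrable (fun y : ℝ => 1 / (y + t))
      (ENNReal.ofReal (mpAtom γ) • Measure.dirac 0) :=
    (integrable_dirac (by simp)).smul_measure ENNReal.ofReal_ne_top
  rw [mpMeasure, integral_add_measure hdirac hcont, integral_smul_measure, integral_dirac,
    integral_withDensity_eq_integral_toReal_smul₀ hm' htop]
  simp only [ENNReal.toReal_ofReal (mpDensity_nonneg hγ _),
    ENNReal.toReal_ofReal (mpAtom_nonneg hγ), smul_eq_mul]
  rw [integral_mpDensity_div hγ ht, mpAtom_eq hγ,
    show (1 + γ + t) ^ 2 - 4 * γ = (t + 1 - γ) ^ 2 + 4 * γ * t by ring]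
  field_simp
  ring

/-- The Stieltjes transform of the Marchenko–Pastur law is the positive solution of the
self-consistent equation. -/
theorem mpMeasure_selfConsistent (hγ : 0 < γ) {t : ℝ} (ht : 0 < t) {m : ℝ}
    (hm : m = ∫ y, 1 / (y + t) ∂(mpMeasure γ)) :
    0 < m ∧ γ * t * m ^ 2 + (t + 1 - γ) * m - 1 = 0 := by
  rw [integral_mpMeasure hγ ht] at hm
  set s := √((t + 1 - γ) ^ 2 + 4 * γ * t) with hs
  have hs2 : s ^ 2 = (t + 1 - γ) ^ 2 + 4 * γ * t := Real.sq_sqrt (by positivity)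
  have hs0 : 0 ≤ s := Real.sqrt_nonneg _
  have hlt : t + 1 - γ < s := by
    apply Real.lt_sqrt_of_sq_lt
    have : 0 < 4 * γ * t := by positivity
    linarith
  have hm' : 2 * γ * t * m = s - (t + 1 - γ) := by
    rw [hm]
    field_simp
  refine ⟨by rw [hm]; exact div_pos (by linarith) (by positivity), ?_⟩
  have h4 : 4 * γ * t * (γ * t * m ^ 2 + (t + 1 - γ) * m - 1) = 0 := by
    linear_combination (2 * γ * t * m + s + (t + 1 - γ)) * hm' + hs2
  exact (mul_eq_zero.1 h4).resolve_left (by positivity)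

/-- The mass at `x` is at most the increment of the distribution function over `(y, x]`, for every
`y < x`. -/
theorem mpMeasure_singleton_of_continuousAt (hγ : 0 < γ) {x : ℝ}
    (hx : ContinuousAt (mpCDF γ) x) : mpMeasure γ {x} = 0 := by
  have := isProbabilityMeasure_mpMeasure hγ
  have h1 : ∀ y < x, (mpMeasure γ).real {x} ≤ mpCDF γ x - mpCDF γ y := by
    intro y hy
    rw [← mpMeasure_real_Iic hγ, ← mpMeasure_real_Iic hγ,
      ← measureReal_sdiff (Set.Iic_subset_Iic.2 hy.le) measurableSet_Iic]
    refine measureReal_mono ?_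
    rintro _ rfl
    exact ⟨Set.mem_Iic.2 le_rfl, fun h => not_le.2 hy h⟩
  have h2 : Tendsto (fun y => mpCDF γ x - mpCDF γ y) (𝓝[<] x) (𝓝 0) := by
    simpa using (hx.tendsto.mono_left nhdsWithin_le_nhds).const_sub (mpCDF γ x)
  have h3 : (mpMeasure γ).real {x} ≤ 0 :=
    ge_of_tendsto h2 (by filter_upwards [self_mem_nhdsWithin] with y hy using h1 y hy)
  have h4 : (mpMeasure γ).real {x} = 0 := le_antisymm h3 measureReal_nonneg
  exact (measureReal_eq_zero_iff).1 h4

end MarchenkoPastur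

/-! ### From Stieltjes transforms to weak convergence. -/

section WeakConvergence

open unitInterval

/-- The functions `x ↦ 1 / (x + t)` on `[0, ∞]`, in the coordinate `y = 1 / (1 + x)`. -/
def stieltjesKernel : C(Set.Ioi (0 : ℝ), C(I, ℝ)) :=
  ContinuousMap.curry ⟨fun q => (q.2 : ℝ) / ((1 - q.2) + q.1 * q.2), by
    refine Continuous.div (by fun_prop) (by fun_prop) fun q => ?_
    have h1 := q.2.2.1
    have h2 := q.2.2.2
    have h3 : (0 : ℝ) < q.1 := q.1.2
    rcases h1.eq_or_lt with h | h
    · rw [← h]; norm_num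
    · have := mul_pos h3 h
      linarith⟩

theorem stieltjesKernel_den_pos (t : Set.Ioi (0 : ℝ)) (y : I) : 0 < (1 - (y : ℝ)) + t * y := by
  have h1 := y.2.1
  have h2 := y.2.2
  have h3 : (0 : ℝ) < t := t.2
  rcases h1.eq_or_lt with h | h
  · rw [← h]; norm_num
  · have := mul_pos h3 h
    linarith

theorem stieltjesKernel_apply (t : Set.Ioi (0 : ℝ)) (y : I) :
    stieltjesKernel t y = (y : ℝ) / ((1 - y) + t * y) := rfl

theorem stieltjesKernel_mul {s t : Set.Ioi (0 : ℝ)} (h : (s : ℝ) ≠ t) :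
    stieltjesKernel s * stieltjesKernel t =
      (1 / ((s : ℝ) - t)) • (stieltjesKernel t - stieltjesKernel s) := by
  ext y
  have h1 := (stieltjesKernel_den_pos s y).ne'
  have h2 := (stieltjesKernel_den_pos t y).ne'
  have h3 := sub_ne_zero.2 h
  simp only [ContinuousMap.mul_apply, ContinuousMap.smul_apply, ContinuousMap.sub_apply,
    stieltjesKernel_apply, smul_eq_mul]
  rw [div_mul_div_comm, div_sub_div _ _ h2 h1, one_div_mul_eq_div, div_div,
    div_eq_div_iff (mul_ne_zero h1 h2) (mul_ne_zero (mul_ne_zero h2 h1) h3)]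
  ring

/-- The closed span of the Stieltjes kernels. -/
def kernelSpan : Submodule ℝ C(I, ℝ) :=
  (Submodule.span ℝ (Set.range stieltjesKernel)).topologicalClosure

theorem stieltjesKernel_mem (t : Set.Ioi (0 : ℝ)) : stieltjesKernel t ∈ kernelSpan :=
  Submodule.le_topologicalClosure _ (Submodule.subset_span ⟨t, rfl⟩)

theorem isClosed_kernelSpan : IsClosed (kernelSpan : Set C(I, ℝ)) :=
  Submodule.isClosed_topologicalClosure _

/-- For `s ≠ t` this is the partial fraction identity; the square follows as `t → s`, since the span
is closed. -/
theorem stieltjesKernel_mul_mem (s t : Set.Ioi (0 : ℝ)) :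
    stieltjesKernel s * stieltjesKernel t ∈ kernelSpan := by
  have hcl : IsClosed {t | stieltjesKernel s * stieltjesKernel t ∈ kernelSpan} :=
    isClosed_kernelSpan.preimage (continuous_const.mul stieltjesKernel.continuous)
  have hd : Dense ({s}ᶜ : Set (Set.Ioi (0 : ℝ))) := dense_compl_singleton s
  have hsub : ({s}ᶜ : Set (Set.Ioi (0 : ℝ))) ⊆
      {t | stieltjesKernel s * stieltjesKernel t ∈ kernelSpan} := by
    intro t ht
    have hne : (s : ℝ) ≠ t := fun h => ht (Subtype.ext h.symm)
    change stieltjesKernel s * stieltjesKernel t ∈ kernelSpan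
    rw [stieltjesKernel_mul hne]
    exact kernelSpan.smul_mem _ (kernelSpan.sub_mem (stieltjesKernel_mem t)
      (stieltjesKernel_mem s))
  exact hcl.closure_subset_iff.2 hsub (hd t)

theorem mul_mem_kernelSpan (s : Set.Ioi (0 : ℝ)) {g : C(I, ℝ)} (hg : g ∈ kernelSpan) :
    stieltjesKernel s * g ∈ kernelSpan := by
  have h1 : Submodule.span ℝ (Set.range stieltjesKernel) ≤
      kernelSpan.comap (LinearMap.mulLeft ℝ (stieltjesKernel s)) := by
    rw [Submodule.span_le]
    rintro _ ⟨t, rfl⟩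
    exact stieltjesKernel_mul_mem s t
  have hcl : IsClosed {g | stieltjesKernel s * g ∈ kernelSpan} :=
    isClosed_kernelSpan.preimage (continuous_const.mul continuous_id)
  exact hcl.closure_subset_iff.2 h1 hg

/-- The kernel at `t = 1` is the coordinate `y`, and `kernelSpan` is stable under multiplication by
kernels, so it contains every `y ^ (k + 1)`; with constants, Weierstrass applies. `W` itself is only
assumed to be a closed subspace, as convergence of integrals gives no multiplicativity. -/
theorem eq_top_of_stieltjesKernel_mem {W : Submodule ℝ C(I, ℝ)} (hW : IsClosed (W : Set C(I, ℝ)))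
    (h1 : 1 ∈ W) {D : Set (Set.Ioi (0 : ℝ))} (hD : Dense D)
    (hDW : ∀ t ∈ D, stieltjesKernel t ∈ W) : W = ⊤ := by
  have hall : ∀ t, stieltjesKernel t ∈ W := fun t =>
    (hW.preimage stieltjesKernel.continuous).closure_subset_iff.2 hDW (hD t)
  have hV : kernelSpan ≤ W := Submodule.topologicalClosure_minimal _
    (Submodule.span_le.2 (by rintro _ ⟨t, rfl⟩; exact hall t)) hW
  have hone : stieltjesKernel ⟨1, Set.mem_Ioi.2 one_pos⟩ = Polynomial.X.toContinuousMapOn I := by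
    ext y
    simp [stieltjesKernel_apply]
  have hpow : ∀ k : ℕ, (Polynomial.X ^ (k + 1) : Polynomial ℝ).toContinuousMapOn I ∈ kernelSpan := by
    intro k
    induction k with
    | zero =>
      rw [zero_add, pow_one, ← hone]
      exact stieltjesKernel_mem _
    | succ k ih =>
      have := mul_mem_kernelSpan ⟨1, Set.mem_Ioi.2 one_pos⟩ ih
      rw [hone] at this
      convert this using 1
      ext y
      simp [pow_succ, mul_comm]
  have hpoly : ∀ q : Polynomial ℝ, q.toContinuousMapOn I ∈ W := by
    intro q
    induction q using Polynomial.induction_on' with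
    | add p q hp hq =>
      convert W.add_mem hp hq using 1
      ext y
      simp
    | monomial k a =>
      have : (Polynomial.monomial k a).toContinuousMapOn I =
          a • (Polynomial.X ^ k : Polynomial ℝ).toContinuousMapOn I := by
        ext y
        simp
      rw [this]
      refine W.smul_mem _ ?_
      cases k with
      | zero =>
        convert h1 using 1
        ext y
        simp
      | succ k => exact hV (hpow k)
  rw [eq_top_iff]
  intro g _
  have hg : g ∈ (polynomialFunctions I).topologicalClosure := by
    rw [polynomialFunctions_closure_eq_top']
    trivial
  refine closure_minimal ?_ hW hg
  intro f hf
  obtain ⟨q, -, rfl⟩ := hf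
  exact hpoly q

/-- The homeomorphism `x ↦ 1 / (1 + x)` of `[0, ∞)` onto `(0, 1]`, extended to `ℝ`. -/
def toUnit (x : ℝ) : I :=
  ⟨1 / (1 + |x|), by positivity, div_le_one_of_le₀ (by linarith [abs_nonneg x]) (by positivity)⟩

theorem continuous_toUnit : Continuous toUnit := by
  unfold toUnit
  refine Continuous.subtype_mk (Continuous.div (by fun_prop) (by fun_prop) fun x => ?_) _
  positivity

theorem stieltjesKernel_toUnit {x : ℝ} (hx : 0 ≤ x) (t : Set.Ioi (0 : ℝ)) :
    stieltjesKernel t (toUnit x) = 1 / (x + t) := by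
  have ht : (0 : ℝ) < t := t.2
  have := stieltjesKernel_den_pos t (toUnit x)
  rw [stieltjesKernel_apply]
  simp only [toUnit, abs_of_nonneg hx] at this ⊢
  have hx' : 1 + x ≠ 0 := by positivity
  have hxt : x + t ≠ 0 := by positivity
  rw [div_eq_div_iff this.ne' hxt]
  field_simp
  ring

theorem toUnit_le_toUnit_iff {x y : ℝ} (hx : 0 ≤ x) (hy : 0 ≤ y) : toUnit x ≤ toUnit y ↔ y ≤ x := by
  rw [← Subtype.coe_le_coe]
  simp only [toUnit, abs_of_nonneg hx, abs_of_nonneg hy]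
  rw [div_le_div_iff_of_pos_left one_pos (by positivity) (by positivity)]
  constructor <;> intro h <;> linarith

/-- The functions whose integrals converge form a subspace, closed because integration against a
probability measure is 1-Lipschitz in the sup norm, and it contains the constants. -/
theorem tendsto_integral_of_stieltjes {ρ : ℕ → Measure I} [∀ n, IsProbabilityMeasure (ρ n)]
    {ρ₀ : Measure I} [IsProbabilityMeasure ρ₀] {D : Set (Set.Ioi (0 : ℝ))} (hD : Dense D)
    (h : ∀ t ∈ D, Tendsto (fun n => ∫ y, stieltjesKernel t y ∂(ρ n)) atTop
      (𝓝 (∫ y, stieltjesKernel t y ∂ρ₀))) (f : C(I, ℝ)) :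
    Tendsto (fun n => ∫ y, f y ∂(ρ n)) atTop (𝓝 (∫ y, f y ∂ρ₀)) := by
  have hint : ∀ (ρ : Measure I) [IsProbabilityMeasure ρ] (f : C(I, ℝ)), Integrable f ρ :=
    fun ρ _ f => f.continuous.integrable_of_hasCompactSupport
      (HasCompactSupport.of_compactSpace f)
  have hlip : ∀ (ρ : Measure I) [IsProbabilityMeasure ρ] (f g : C(I, ℝ)),
      |∫ y, f y ∂ρ - ∫ y, g y ∂ρ| ≤ dist f g := by
    intro ρ _ f g
    rw [← integral_sub (hint ρ f) (hint ρ g)]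
    have := norm_integral_le_of_norm_le_const (μ := ρ) (f := fun y => f y - g y)
      (C := dist f g) (ae_of_all _ fun y => by
        rw [← dist_eq_norm]; exact ContinuousMap.dist_apply_le_dist y)
    simpa using this
  let W : Submodule ℝ C(I, ℝ) :=
    { carrier := {f | Tendsto (fun n => ∫ y, f y ∂(ρ n)) atTop (𝓝 (∫ y, f y ∂ρ₀))}
      add_mem' := by
        intro f g hf hg
        have := Tendsto.add hf hg
        simpa only [Set.mem_ofPred_eq, ContinuousMap.add_apply, integral_add (hint _ f) (hint _ g)]
          using this
      zero_mem' := by simp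
      smul_mem' := by
        intro c f hf
        have := Tendsto.const_mul c hf
        simpa only [Set.mem_ofPred_eq, ContinuousMap.smul_apply, smul_eq_mul, integral_const_mul]
          using this }
  have hW : IsClosed (W : Set C(I, ℝ)) := by
    refine isClosed_of_closure_subset fun f hf => ?_
    change Tendsto _ _ _
    rw [Metric.tendsto_atTop]
    intro ε hε
    obtain ⟨g, hg, hfg⟩ := Metric.mem_closure_iff.1 hf (ε / 3) (by positivity)
    obtain ⟨n₀, hn₀⟩ := Metric.tendsto_atTop.1 (show Tendsto _ _ _ from hg) (ε / 3) (by positivity)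
    refine ⟨n₀, fun n hn => ?_⟩
    have e1 := hn₀ n hn
    have e2 := hlip (ρ n) f g
    have e3 := hlip ρ₀ f g
    rw [Real.dist_eq] at e1 ⊢
    have e4 := abs_sub_le (∫ y, f y ∂(ρ n)) (∫ y, g y ∂(ρ n)) (∫ y, f y ∂ρ₀)
    have e5 := abs_sub_le (∫ y, g y ∂(ρ n)) (∫ y, g y ∂ρ₀) (∫ y, f y ∂ρ₀)
    rw [abs_sub_comm (∫ y, g y ∂ρ₀)] at e5
    linarith
  have htop := eq_top_of_stieltjesKernel_mem hW (by simp [W]) hD h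
  exact (htop ▸ Submodule.mem_top : f ∈ W)

/-- Convergence of the Stieltjes transforms on a dense set of negative reals implies convergence
of the distribution functions. -/
theorem tendsto_cdf_of_stieltjes {ν : ℕ → Measure ℝ} [∀ n, IsProbabilityMeasure (ν n)]
    {ν₀ : Measure ℝ} [IsProbabilityMeasure ν₀] (hν : ∀ n, ν n (Set.Iio 0) = 0)
    (hν₀ : ν₀ (Set.Iio 0) = 0) {D : Set (Set.Ioi (0 : ℝ))} (hD : Dense D)
    (h : ∀ t ∈ D, Tendsto (fun n => ∫ x, 1 / (x + (t : ℝ)) ∂(ν n)) atTop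
      (𝓝 (∫ x, 1 / (x + (t : ℝ)) ∂ν₀))) {x : ℝ} (hx : ν₀ {x} = 0) :
    Tendsto (fun n => (ν n).real (Set.Iic x)) atTop (𝓝 (ν₀.real (Set.Iic x))) := by
  rcases lt_or_ge x 0 with hx0 | hx0
  · have hz : ∀ ρ : Measure ℝ, ρ (Set.Iio 0) = 0 → ρ.real (Set.Iic x) = 0 := fun ρ hρ => by
      rw [measureReal_def, measure_mono_null (Set.Iic_subset_Iio.2 hx0) hρ, ENNReal.toReal_zero]
    simp only [hz _ (hν _), hz _ hν₀]
    exact tendsto_const_nhds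
  have hpos : ∀ ρ : Measure ℝ, ρ (Set.Iio 0) = 0 → ∀ᵐ y ∂ρ, 0 ≤ y := fun ρ hρ => by
    rw [ae_iff]
    convert hρ using 2
    ext y
    simp
  have hker : ∀ (ρ : Measure ℝ), ρ (Set.Iio 0) = 0 → ∀ t : Set.Ioi (0 : ℝ),
      ∫ y, stieltjesKernel t y ∂(ρ.map toUnit) = ∫ y, 1 / (y + (t : ℝ)) ∂ρ := by
    intro ρ hρ t
    rw [integral_map continuous_toUnit.aemeasurable
      (stieltjesKernel t).continuous.aestronglyMeasurable]
    refine integral_congr_ae ?_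
    filter_upwards [hpos ρ hρ] with y hy
    exact stieltjesKernel_toUnit hy t
  -- `toUnit` reverses the order on `[0, ∞)`, so lower half-lines become upper ones.
  have hset : ∀ ρ : Measure ℝ, ρ (Set.Iio 0) = 0 →
      (ρ.map toUnit) (Set.Ici (toUnit x)) = ρ (Set.Iic x) := by
    intro ρ hρ
    rw [Measure.map_apply continuous_toUnit.measurable measurableSet_Ici]
    refine measure_congr ?_
    filter_upwards [hpos ρ hρ] with y hy
    exact propext (toUnit_le_toUnit_iff hx0 hy)
  have hP : ∀ ρ : Measure ℝ, IsProbabilityMeasure ρ → IsProbabilityMeasure (ρ.map toUnit) :=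
    fun ρ _ => Measure.isProbabilityMeasure_map continuous_toUnit.aemeasurable
  have i1 : ∀ n, IsProbabilityMeasure ((ν n).map toUnit) := fun n => hP _ inferInstance
  have i2 : IsProbabilityMeasure (ν₀.map toUnit) := hP _ inferInstance
  let ρ : ℕ → ProbabilityMeasure I := fun n => ⟨(ν n).map toUnit, i1 n⟩
  let ρ₀ : ProbabilityMeasure I := ⟨ν₀.map toUnit, i2⟩
  have hlim : Tendsto ρ atTop (𝓝 ρ₀) := by
    rw [ProbabilityMeasure.tendsto_iff_forall_integral_tendsto]
    intro f
    refine tendsto_integral_of_stieltjes (ρ := fun n => (ν n).map toUnit)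
      (ρ₀ := ν₀.map toUnit) hD (fun t ht => ?_) f.toContinuousMap
    simp only [hker _ (hν _), hker _ hν₀]
    exact h t ht
  have hfr : (ν₀.map toUnit) (frontier (Set.Ici (toUnit x))) = 0 := by
    refine measure_mono_null (frontier_Ici_subset _) ?_
    rw [Measure.map_apply continuous_toUnit.measurable (measurableSet_singleton _)]
    refine (measure_congr ?_).trans hx
    filter_upwards [hpos ν₀ hν₀] with y hy
    refine propext ⟨fun hy' => ?_, fun hy' => ?_⟩
    · have hy'' : toUnit y = toUnit x := hy'
      exact le_antisymm ((toUnit_le_toUnit_iff hx0 hy).1 hy''.ge) ((toUnit_le_toUnit_iff hy hx0).1 hy''.le)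
    · have hy'' : y = x := hy'
      exact congrArg toUnit hy''
  have := ProbabilityMeasure.tendsto_measure_of_null_frontier_of_tendsto' hlim hfr
  have h2 := (ENNReal.tendsto_toReal (measure_ne_top _ _)).comp this
  simp only [ρ, ρ₀, Function.comp_def, ProbabilityMeasure.coe_mk, hset _ (hν _), hset _ hν₀] at h2
  exact h2

end WeakConvergence

/-! ### The spectral distribution as a measure. -/

section Empirical

variable {ι : Type*} [Fintype ι]

/-- The uniform distribution on a finite family of reals. -/
def empiricalMeasure (l : ι → ℝ) : Measure ℝ :=
  (Fintype.card ι : ENNReal)⁻¹ • ∑ i, Measure.dirac (l i)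

theorem isProbabilityMeasure_empiricalMeasure [Nonempty ι] (l : ι → ℝ) :
    IsProbabilityMeasure (empiricalMeasure l) := by
  refine ⟨?_⟩
  rw [empiricalMeasure, Measure.smul_apply, Measure.finsetSum_apply]
  simp only [measure_univ, Finset.sum_const, Finset.card_univ, nsmul_eq_mul, mul_one, smul_eq_mul]
  exact ENNReal.inv_mul_cancel (by simp) (by simp)

theorem empiricalMeasure_real_Iic (l : ι → ℝ) (x : ℝ) :
    (empiricalMeasure l).real (Set.Iic x) =
      (1 / (Fintype.card ι : ℝ)) * ∑ i, (Set.Ici (l i)).indicator 1 x := by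
  rw [measureReal_def, empiricalMeasure, Measure.smul_apply, Measure.finsetSum_apply, smul_eq_mul,
    ENNReal.toReal_mul, ENNReal.toReal_inv, ENNReal.toReal_natCast, one_div,
    ENNReal.toReal_sum (fun i _ => measure_ne_top _ _)]
  congr 1
  refine Finset.sum_congr rfl fun i _ => ?_
  rw [Measure.dirac_apply' _ measurableSet_Iic]
  by_cases h : l i ≤ x
  · simp [Set.indicator, h]
  · simp [Set.indicator, h]

theorem integral_empiricalMeasure (l : ι → ℝ) (f : ℝ → ℝ) :
    ∫ x, f x ∂(empiricalMeasure l) = (1 / (Fintype.card ι : ℝ)) * ∑ i, f (l i) := by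
  rw [empiricalMeasure, integral_smul_measure, integral_finsetSum_measure
    fun i _ => integrable_dirac (by simp)]
  simp

theorem empiricalMeasure_Iio_zero {l : ι → ℝ} (hl : ∀ i, 0 ≤ l i) :
    empiricalMeasure l (Set.Iio 0) = 0 := by
  rw [empiricalMeasure, Measure.smul_apply, Measure.finsetSum_apply]
  have : ∀ i, Measure.dirac (l i) (Set.Iio (0 : ℝ)) = 0 := fun i => by
    rw [Measure.dirac_apply' _ measurableSet_Iio]
    simp [Set.indicator, hl i]
  simp [this]

end Empirical

/-! ### Growth of `N`, Borel–Cantelli, and the variance rate. -/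

section Asymptotics

theorem le_choose_of_lt {n d : ℕ} (hd : 1 ≤ d) (hdn : d < n) : n ≤ n.choose d := by
  induction n generalizing d with
  | zero => omega
  | succ n ih =>
    obtain ⟨e, rfl⟩ : ∃ e, d = e + 1 := ⟨d - 1, by omega⟩
    rw [Nat.choose_succ_succ']
    have h1 : 0 < n.choose e := Nat.choose_pos (by omega)
    rcases (show e + 1 ≤ n by omega).eq_or_lt with h | h
    · subst h
      simp
    · have := ih (d := e + 1) (by omega) h
      omega

/-- Almost sure convergence from summable tails. -/
theorem ae_tendsto_zero_of_summable {Ω : Type*} [MeasurableSpace Ω] {P : Measure Ω}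
    [IsProbabilityMeasure P] {Y : ℕ → Ω → ℝ}
    (h : ∀ ε > 0, Summable fun n => P.real {ω | ε ≤ |Y n ω|}) :
    ∀ᵐ ω ∂P, Tendsto (fun n => Y n ω) atTop (𝓝 0) := by
  have h1 : ∀ k : ℕ, ∀ᵐ ω ∂P, ∀ᶠ n in atTop, ω ∉ {ω | 1 / ((k : ℝ) + 1) ≤ |Y n ω|} := by
    intro k
    refine ae_eventually_notMem ?_
    have h2 := (h (1 / ((k : ℝ) + 1)) (by positivity)).tsum_ofReal_ne_top
    simpa only [measureReal_def, ENNReal.ofReal_toReal (measure_ne_top P _)] using h2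
  filter_upwards [ae_all_iff.2 h1] with ω hω
  rw [Metric.tendsto_atTop']
  intro ε hε
  obtain ⟨k, hk⟩ := exists_nat_one_div_lt hε
  obtain ⟨N, hN⟩ := eventually_atTop.1 (hω k)
  refine ⟨N, fun n hn => ?_⟩
  have h3 := hN n hn.le
  rw [not_le] at h3
  rw [Real.dist_eq, sub_zero]
  exact h3.trans hk

/-- As `log C ≥ log 2`, the hypothesis forces `log r → ∞`; eventually `log C < (log r) / 2`, so `C /
r` is below `r ^ (-1/2)`. -/
theorem tendsto_div_of_log_div_tendsto {C r : ℕ → ℝ} (hC : ∀ n, 2 ≤ C n)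
    (hr : ∀ᶠ n in atTop, 1 < r n)
    (h : Tendsto (fun n => Real.log (C n) / Real.log (r n)) atTop (𝓝 0)) :
    Tendsto (fun n => C n / r n) atTop (𝓝 0) := by
  have hl2 : 0 < Real.log 2 := Real.log_pos one_lt_two
  have hinf : Tendsto (fun n => Real.log (r n)) atTop atTop := by
    have h1 : Tendsto (fun n => Real.log 2 / Real.log (r n)) atTop (𝓝[>] 0) := by
      refine tendsto_nhdsWithin_iff.2 ⟨squeeze_zero' ?_ ?_ h, ?_⟩
      · filter_upwards [hr] with n hn
        exact div_nonneg hl2.le (Real.log_pos hn).le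
      · filter_upwards [hr] with n hn
        have := Real.log_pos hn
        gcongr
        exact hC n
      · filter_upwards [hr] with n hn
        exact div_pos hl2 (Real.log_pos hn)
    have h2 := h1.inv_tendsto_nhdsGT_zero.const_mul_atTop hl2
    refine h2.congr fun n => ?_
    simp only [Pi.inv_apply, inv_div]
    field_simp
  have h3 : Tendsto (fun n => Real.exp (-(1 / 2 * Real.log (r n)))) atTop (𝓝 0) :=
    Real.tendsto_exp_neg_atTop_nhds_zero.comp (hinf.const_mul_atTop (by norm_num))
  refine squeeze_zero' ?_ ?_ h3
  · filter_upwards [hr] with n hn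
    have := hC n
    positivity
  · filter_upwards [hr, h.eventually (gt_mem_nhds (show (0 : ℝ) < 1 / 2 by norm_num))] with n hn h4
    have hC' : 0 < C n := by linarith [hC n]
    have hr' : 0 < r n := by linarith
    rw [div_lt_iff₀ (Real.log_pos hn)] at h4
    rw [← Real.exp_log (div_pos hC' hr'), Real.exp_le_exp, Real.log_div hC'.ne' hr'.ne']
    linarith

/-- With `M = 4 C²` the exponent `2 M d² / n` equals `8 (C d / √n)²`. -/
theorem tendsto_varianceRate {d : ℕ → ℕ} {C : ℕ → ℝ}
    (h : Tendsto (fun n : ℕ => C n / (√(n : ℝ) / d n)) atTop (𝓝 0)) :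
    Tendsto (fun n => varianceRate n (d n) (4 * C n ^ 2)) atTop (𝓝 0) := by
  have h1 : Tendsto (fun n : ℕ => 8 * (C n / (√(n : ℝ) / d n)) ^ 2) atTop (𝓝 0) := by
    simpa using (h.pow 2).const_mul 8
  have h2 := ((Real.continuous_exp.tendsto 0).comp h1).sub_const 1
  rw [Real.exp_zero, sub_self] at h2
  refine h2.congr fun n => ?_
  simp only [varianceRate, Function.comp_def]
  congr 2
  rw [div_div_eq_mul_div, div_pow, mul_pow, Real.sq_sqrt (Nat.cast_nonneg n)]
  ring

end Asymptotics

/-! ### Almost sure convergence of the resolvent trace. -/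

section Main

variable {Ω : Type*} [MeasurableSpace Ω] {P : Measure Ω} [IsProbabilityMeasure P]

theorem isEntryLaw_of_moments {μ : Measure ℝ} {C : ℝ} (hsymm : μ.map (fun t => -t) = μ)
    (hvar : ∫ t, t ^ 2 ∂μ = 1) (hC : 2 ≤ C)
    (hmom : ∀ k : ℕ, Integrable (fun t : ℝ => t ^ (2 * k)) μ ∧
      ∫ t, t ^ (2 * k) ∂μ ≤ (C * k) ^ k) : IsEntryLaw μ (4 * C ^ 2) where
  symm := hsymm
  integrable k := (hmom k).1
  variance := hvar
  fourth := by
    -- The moment bound at `k = 2` is `(2 C)²`.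
    refine (hmom 2).2.trans_eq ?_
    push_cast
    ring
  two_le := by nlinarith

variable {d p : ℕ → ℕ} {C : ℕ → ℝ} {γ : ℝ} {μ : ℕ → Measure ℝ} [∀ n, IsProbabilityMeasure (μ n)]
  {Z : (n : ℕ) → Ω → Matrix (TensorIndex n (d n)) (Fin (p n)) ℝ}

/-- The expected normalised resolvent trace. -/
def meanResolventTrace (n d p : ℕ) (μ : Measure ℝ) (t : ℝ) : ℝ :=
  ∫ z, resolventTrace t z ∂(Measure.pi fun _ : Fin p => tensorLaw n d μ)

theorem summable_tail {t : ℝ} (ht : 0 < t) (hγ : 0 < γ)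
    (hN : ∀ᶠ n : ℕ in atTop, n ≤ n.choose (d n))
    (hratio : Tendsto (fun n : ℕ => (n.choose (d n) : ℝ) / p n) atTop (𝓝 γ))
    (hcol : ∀ n, HasLaw (fun ω (j : Fin (p n)) s => Z n ω s j)
      (Measure.pi fun _ : Fin (p n) => tensorLaw n (d n) (μ n)) P) {ε : ℝ} (hε : 0 < ε) :
    Summable fun n => P.real {ω | ε ≤ |resolventTrace t (fun j s => Z n ω s j) -
      meanResolventTrace n (d n) (p n) (μ n) t|} := by
  -- With `p` differences of size `1 / (t N)` the exponent is `(ε² t² / 2) (N / p) N`, eventually at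
  -- least `a n` because `N / p ≥ γ / 2` and `N ≥ n`.
  set a := ε ^ 2 * t ^ 2 * γ / 4 with ha
  have ha0 : 0 < a := by positivity
  have hs : Summable fun n : ℕ => 2 * Real.exp (n * (-a)) :=
    (Real.summable_exp_nat_mul_iff.2 (by linarith)).mul_left 2
  refine Summable.of_norm_bounded_eventually_nat hs ?_
  filter_upwards [hN, hratio.eventually (lt_mem_nhds (show γ / 2 < γ by linarith)),
    eventually_gt_atTop 0] with n hn hrat hn0
  rw [Real.norm_of_nonneg measureReal_nonneg]
  have hmeas : Measurable fun z : Fin (p n) → TensorIndex n (d n) → ℝ => resolventTrace t z :=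
    measurable_resolventTrace ht
  rw [(hcol n).measureReal_eq (p := fun z => ε ≤ |resolventTrace t z -
    meanResolventTrace n (d n) (p n) (μ n) t|)
    (measurableSet_le measurable_const (hmeas.sub_const _).abs)]
  set c : NNReal := ⟨1 / t / n.choose (d n), by positivity⟩ with hc
  have hmd := measure_abs_sub_integral_ge_le (tensorLaw n (d n) (μ n)) hmeas
    (abs_resolventTrace_le ht) (c := c) (fun z j w => by
      have := abs_resolventTrace_sub_update_le ht j z w
      rwa [card_tensorIndex] at this) hε.le
  refine hmd.trans ?_
  have hn0' : (0 : ℝ) < n := by exact_mod_cast hn0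
  have hnN : (n : ℝ) ≤ n.choose (d n) := by exact_mod_cast hn
  have hN0 : (0 : ℝ) < n.choose (d n) := hn0'.trans_le hnN
  have hp0 : (0 : ℝ) < p n := by
    rcases (Nat.cast_nonneg (α := ℝ) (p n)).eq_or_lt with h | h
    · rw [← h, div_zero] at hrat
      linarith
    · exact h
  gcongr
  have hcv : (c : ℝ) = 1 / t / n.choose (d n) := rfl
  have e1 : -ε ^ 2 / (2 * (p n * (c : ℝ) ^ 2)) =
      -(ε ^ 2 * t ^ 2 / 2 * (n.choose (d n) / p n) * n.choose (d n)) := by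
    rw [hcv]
    field_simp
  have e2 : ε ^ 2 * t ^ 2 / 2 * (γ / 2) * n ≤
      ε ^ 2 * t ^ 2 / 2 * (n.choose (d n) / p n) * n.choose (d n) := by gcongr
  rw [e1, ha]
  linarith

theorem ae_tendsto_resolventTrace {t : ℝ} (ht : 0 < t) (hγ : 0 < γ)
    (hentry : ∀ n, IsEntryLaw (μ n) (4 * C n ^ 2))
    (hrate : Tendsto (fun n => varianceRate n (d n) (4 * C n ^ 2)) atTop (𝓝 0))
    (hN : ∀ᶠ n : ℕ in atTop, n ≤ n.choose (d n))
    (hratio : Tendsto (fun n : ℕ => (n.choose (d n) : ℝ) / p n) atTop (𝓝 γ))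
    (hcol : ∀ n, HasLaw (fun ω (j : Fin (p n)) s => Z n ω s j)
      (Measure.pi fun _ : Fin (p n) => tensorLaw n (d n) (μ n)) P) :
    ∀ᵐ ω ∂P, Tendsto (fun n => resolventTrace t (fun j s => Z n ω s j)) atTop
      (𝓝 (∫ y, 1 / (y + t) ∂(mpMeasure γ))) := by
  set m : ℕ → ℝ := fun n => meanResolventTrace n (d n) (p n) (μ n) t with hm
  have hconc : ∀ᵐ ω ∂P, Tendsto (fun n => resolventTrace t (fun j s => Z n ω s j) - m n) atTop
      (𝓝 0) :=
    ae_tendsto_zero_of_summable fun ε hε => summable_tail ht hγ hN hratio hcol hε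
  have hm0 : ∀ n, 0 ≤ m n := fun n => integral_nonneg fun z => resolventTrace_nonneg ht z
  have hmb : ∀ n, m n ≤ 1 / t := fun n => by
    have := norm_integral_le_of_norm_le_const
      (μ := Measure.pi fun _ : Fin (p n) => tensorLaw n (d n) (μ n))
      (f := fun z => resolventTrace t z) (C := 1 / t)
      (ae_of_all _ fun z => abs_resolventTrace_le ht z)
    simp only [probReal_univ, mul_one] at this
    exact (le_abs_self _).trans this
  have hmeas : ∀ n, Measurable fun z : Fin (p n) → TensorIndex n (d n) → ℝ =>
      |resolventTrace t z - m n| := fun n => ((measurable_resolventTrace ht).sub_const _).abs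
  -- Transported to `Ω`, the almost sure convergence and the bound `2 / t` give this by dominated
  -- convergence.
  have hdev : Tendsto (fun n => ∫ z, |resolventTrace t z - m n|
      ∂(Measure.pi fun _ : Fin (p n) => tensorLaw n (d n) (μ n))) atTop (𝓝 0) := by
    have h1 : ∀ n, ∫ z, |resolventTrace t z - m n|
        ∂(Measure.pi fun _ : Fin (p n) => tensorLaw n (d n) (μ n)) =
        ∫ ω, |resolventTrace t (fun j s => Z n ω s j) - m n| ∂P := fun n => by
      rw [← (hcol n).map_eq, integral_map (hcol n).aemeasurable (hmeas n).aestronglyMeasurable]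
    simp only [h1]
    have h2 := tendsto_integral_of_dominated_convergence (μ := P)
      (F := fun n ω => |resolventTrace t (fun j s => Z n ω s j) - m n|) (f := fun _ => 0)
      (fun _ => 1 / t + 1 / t)
      (fun n => ((hmeas n).comp_aemeasurable (hcol n).aemeasurable).aestronglyMeasurable)
      (integrable_const _)
      (fun n => ae_of_all _ fun ω => by
        rw [Real.norm_eq_abs, abs_abs]
        refine (abs_sub _ _).trans (add_le_add (abs_resolventTrace_le ht _) ?_)
        rw [abs_of_nonneg (hm0 n)]
        exact hmb n)
      (by
        filter_upwards [hconc] with ω hω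
        simpa using hω.abs)
    simpa using h2
  have hNinf : Tendsto (fun n : ℕ => (n.choose (d n) : ℝ)) atTop atTop :=
    tendsto_natCast_atTop_atTop.comp (tendsto_atTop_mono' _ hN tendsto_id)
  have hpinv : Tendsto (fun n => 1 / t / (p n : ℝ)) atTop (𝓝 0) := by
    have h1 : Tendsto (fun n : ℕ => 1 / t * ((n.choose (d n) : ℝ) / p n *
        (n.choose (d n) : ℝ)⁻¹)) atTop (𝓝 0) := by
      simpa using (hratio.mul hNinf.inv_tendsto_atTop).const_mul (1 / t)
    refine h1.congr' ?_
    filter_upwards [hNinf.eventually_gt_atTop 0] with n hn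
    field_simp
  have herr : Tendsto (fun n : ℕ => √(4 * (((n.choose (d n) : ℝ) / p n) ^ 2 * (1 / t) ^ 2 *
      varianceRate n (d n) (4 * C n ^ 2))) + 1 / t / p n +
      ((n.choose (d n) : ℝ) / p n) * ∫ z, |resolventTrace t z - m n|
        ∂(Measure.pi fun _ : Fin (p n) => tensorLaw n (d n) (μ n))) atTop (𝓝 0) := by
    have h1 := ((((hratio.pow 2).mul_const ((1 / t) ^ 2)).mul hrate).const_mul 4).sqrt
    simpa using (h1.add hpinv).add (hratio.mul hdev)
  obtain ⟨hpos, heq⟩ := mpMeasure_selfConsistent hγ ht rfl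
  have hlim : Tendsto m atTop (𝓝 (∫ y, 1 / (y + t) ∂(mpMeasure γ))) := by
    refine tendsto_of_selfConsistent hγ ht hpos heq hratio hm0 hmb ?_
    refine squeeze_zero_norm' ?_ herr
    filter_upwards [hratio.eventually (lt_mem_nhds hγ), hNinf.eventually_gt_atTop 0] with n hr hn
    refine abs_selfConsistent_le (hentry n) ht ?_ (by exact_mod_cast hn) rfl
    -- If `p n = 0`, the quotient `N / p` would be `0` by convention, yet it is eventually positive.
    by_contra! h0
    rw [Nat.le_zero.1 h0] at hr
    simp at hr
  filter_upwards [hconc] with ω hω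
  simpa using hω.add hlim

end Main

end RandomTensor

end

open RandomTensor in

theorem mainTheorem1 {Ω : Type*} [MeasurableSpace Ω] (P : Measure Ω) [IsProbabilityMeasure P]
    (d p : ℕ → ℕ) (C : ℕ → ℝ) (γ : ℝ)
    -- `μ n` is the law of `x₁ = x(n)`
    (μ : ℕ → Measure ℝ) [∀ n, IsProbabilityMeasure (μ n)]
    (Z : (n : ℕ) → Ω → Matrix (RandomTensor.TensorIndex n (d n)) (Fin (p n)) ℝ)
    -- `1 ≤ d < n^{1/2}`
    (hd : ∀ᶠ n : ℕ in atTop, 1 ≤ d n ∧ (d n : ℝ) < √(n : ℝ))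
    -- the entries are symmetric with unit variance and controlled even moments
    (hsymm : ∀ n, (μ n).map (fun t => -t) = μ n)
    (hvar : ∀ n, ∫ t, t ^ 2 ∂(μ n) = 1)
    (hC : ∀ n, 2 ≤ C n)
    (hmom : ∀ n k : ℕ, Integrable (fun t : ℝ => t ^ (2 * k)) (μ n) ∧
      ∫ t, t ^ (2 * k) ∂(μ n) ≤ (C n * k) ^ k)
    (hClim : Tendsto (fun n : ℕ => Real.log (C n) / Real.log (√(n : ℝ) / d n)) atTop (𝓝 0))
    -- `N / p → γ ∈ (0, ∞)`, with `N = n.choose d`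
    (hγ : 0 < γ)
    (hratio : Tendsto (fun n : ℕ => (n.choose (d n) : ℝ) / p n) atTop (𝓝 γ))
    -- the columns of `Z n` are i.i.d. with the law of the random tensor product
    (hindep : ∀ n, iIndepFun (fun (j : Fin (p n)) (ω : Ω) => fun s => Z n ω s j) P)
    (hlaw : ∀ n (j : Fin (p n)),
      HasLaw (fun ω s => Z n ω s j) (RandomTensor.tensorLaw n (d n) (μ n)) P) :
    ∀ᵐ ω ∂P, RandomTensor.WeaklyConverges
      (fun n => RandomTensor.esd (RandomTensor.sampleCov_isHermitian (Z n ω)))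
      (RandomTensor.mpCDF γ) := by
  have hr : ∀ᶠ n : ℕ in atTop, 1 < √(n : ℝ) / d n := by
    filter_upwards [hd] with n hn
    have : (0 : ℝ) < d n := by exact_mod_cast hn.1
    rw [lt_div_iff₀ this, one_mul]
    exact hn.2
  have hN : ∀ᶠ n : ℕ in atTop, n ≤ n.choose (d n) := by
    filter_upwards [hd] with n hn
    refine le_choose_of_lt hn.1 ?_
    have h1 : (d n : ℝ) ^ 2 < n := (Real.lt_sqrt (by positivity)).1 hn.2
    have h2 : d n ^ 2 < n := by exact_mod_cast h1
    nlinarith [hn.1]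
  have hrate := tendsto_varianceRate (tendsto_div_of_log_div_tendsto hC hr hClim)
  have hentry : ∀ n, IsEntryLaw (μ n) (4 * C n ^ 2) := fun n =>
    isEntryLaw_of_moments (hsymm n) (hvar n) (hC n) (hmom n)
  have hcol := fun n => (hindep n).hasLaw_pi (hlaw n)
  -- Countably many `t` leave a single exceptional null set, chosen before `x`.
  obtain ⟨D, hDc, hD⟩ := TopologicalSpace.exists_countable_dense (Set.Ioi (0 : ℝ))
  have hae := (ae_ball_iff hDc).2 fun (t : Set.Ioi (0 : ℝ)) _ =>
    ae_tendsto_resolventTrace t.2 hγ hentry hrate hN hratio hcol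
  filter_upwards [hae] with ω hω
  intro x hx
  have := isProbabilityMeasure_mpMeasure hγ
  -- The Dirac mass replaces the empirical measure for the finitely many `n` with no indices, as
  -- `tendsto_cdf_of_stieltjes` needs a probability measure for every `n`.
  let ν : ℕ → Measure ℝ := fun n =>
    if 0 < n.choose (d n) then
      empiricalMeasure (sampleCov_isHermitian (Z n ω)).eigenvalues
    else Measure.dirac 0
  have hνP : ∀ n, IsProbabilityMeasure (ν n) := by
    intro n
    by_cases h : 0 < n.choose (d n)
    · have : Nonempty (TensorIndex n (d n)) := by
        rwa [← Fintype.card_pos_iff, card_tensorIndex]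
      simp only [ν, h, if_true]
      exact isProbabilityMeasure_empiricalMeasure _
    · simp only [ν, h, if_false]
      infer_instance
  have hν0 : ∀ n, ν n (Set.Iio 0) = 0 := by
    intro n
    by_cases h : 0 < n.choose (d n)
    · simp only [ν, h, if_true]
      exact empiricalMeasure_Iio_zero (eigenvalues_sampleCov_nonneg (Z n ω))
    · simp only [ν, h, if_false]
      simp
  have hpos : ∀ᶠ n : ℕ in atTop, 0 < n.choose (d n) := by
    filter_upwards [hN, eventually_gt_atTop 0] with n h1 h2
    exact h2.trans_le h1
  have hst : ∀ t ∈ D, Tendsto (fun n => ∫ y, 1 / (y + (t : ℝ)) ∂(ν n)) atTop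
      (𝓝 (∫ y, 1 / (y + (t : ℝ)) ∂(mpMeasure γ))) := by
    intro t ht
    refine (hω t ht).congr' ?_
    filter_upwards [hpos] with n hn
    simp only [ν, hn, if_true]
    rw [integral_empiricalMeasure, resolventTrace_eq_sum t.2]
  have hlim := tendsto_cdf_of_stieltjes hν0 (mpMeasure_Iio_zero γ) hD hst
    (mpMeasure_singleton_of_continuousAt hγ hx)
  rw [mpMeasure_real_Iic hγ] at hlim
  refine hlim.congr' ?_
  filter_upwards [hpos] with n hn
  simp only [ν, hn, if_true]
  rw [empiricalMeasure_real_Iic]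
  rfl
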